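/- There is an absolute constant $C>0$ such that the following holds for every universe $V$ of nodes, every $T\ge 2$, all $\varepsilon,\delta>0$, and all integers $D\ge 1$, $W\ge 1$, $\tau\ge 0$, $k\ge 0$. Put $L:=C\cdot(\log T)^{3/2}\cdot\frac{\log(1/\delta)}{\varepsilon}$. **Inputs.** A graph sequence of length $T$ consists of finite simple undirected graphs $G_t=(V_t,E_t)$, $0\le t\le T$, with $V_t\subseteq V$, a positive integer weight for each edge where edge weights are considered, and updates $V_t=(V_{t-1}\setminus V^-_t)\cup V^+_t$, $E_t=(E_{t-1}\setminus E^-_t)\cup E^+_t$; if a node is deleted, so are all its incident edges, and both endpoints of an inserted edge lie in $V_t$. The sequence is partially dynamic if it is incremental ($V^-_t=E^-_t=\emptyset$ for all $t$) or decremental ($V^+_t=E^+_t=\emptyset$ for all $t$). **Adjacency (event level).** Two sequences of length $T$ with the same $G_0$ are edge-adjacent if, up to exchanging them, all their updates (and the weights of all other edges) agree except that one insertion, or one deletion, of a single edge $e^*$ at a single time step is missing in the second. They are node-adjacent if, up to exchanging them, one insertion, or one deletion, of a single node $v^*$ at a single time step is missing in the second, all other node updates agree, all edge updates and weights of edges not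 incident to $v^*$ agree, and in the first sequence every inserted (deleted) edge is incident to a node inserted (deleted) in the same step. **Algorithms.** An algorithm outputs at each time $t=1,\dots,T$ a real number (or vector), and the joint law of its outputs up to time $t$ is determined by $G_1,\dots,G_t$. It is $\varepsilon$-edge- (resp. $\varepsilon$-node-) differentially private if $\Pr[\mathcal A(\mathcal G)\in B]\le e^{\varepsilon}\Pr[\mathcal A(\mathcal G')\in B]$ for all edge-adjacent (resp. node-adjacent) admissible inputs $\mathcal G,\mathcal G'$ and all measurable sets $B$ of output sequences. It estimates $f$ with additive error $\alpha$ if on every admissible input, at each time $t$, its output (each coordinate of it, if $f$ is vector-valued) differs from $f(G_t)$ by at most $\alpha$ with probability at least $1-\delta$. **Claim.** For each of the following graph functions there are an $\varepsilon$-edge-differentially private algorithm and an $\varepsilon$-node-differentially private algorithm that estimate it on partially dynamic graph sequences of length $T$ with the following additive errors: | graph function | edge-private | node-private | |---|---|---| | weight of a minimum spanning tree (forest, if disconnected) | $W\cdot L$ | $DW\cdot L$ | | number of edges | $L$ | $D\cdot L$ | | number of nodes of degree at least $\tau$ | $L$ | $D\cdot L$ | | degree histogram (number of nodes of degree $j$,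 $0\le j\le D$) | $D\cdot L$ | $D^2\cdot L$ | | number of triangles | $D\cdot L$ | $D^2\cdot L$ | | number of $k$-stars (a center with $k$ distinct incident edges) | $D^k\cdot L$ | $D^k\cdot L$ | Here the admissible inputs are the partially dynamic sequences in which, wherever the bound (or the function) involves $D$, all of $G_1,\dots,G_T$ have maximum degree at most $D$ and, wherever it involves $W$, all edge weights in $G_1,\dots,G_T$ lie in $\{1,\dots,W\}$. -/

import Mathlib

open MeasureTheory

universe u

/-- A finite undirected graph with natural edge weights on a universe `V` of possible nodes.
The weight function is only meaningful on `edges`. -/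
@[ext] structure WGraph (V : Type u) where
  verts : Finset V
  edges : Finset (Sym2 V)
  weight : Sym2 V → ℕ

namespace WGraph

variable {V : Type u} [DecidableEq V]

/-- The edges incident to `v`. -/
def incident (G : WGraph V) (v : V) : Finset (Sym2 V) := {e ∈ G.edges | v ∈ e}

def degree (G : WGraph V) (v : V) : ℕ := (G.incident v).card

def edgeCount (G : WGraph V) : ℕ := G.edges.card

/-- The number of nodes of degree at least `τ`. -/
def highDegreeCount (τ : ℕ) (G : WGraph V) : ℕ := {v ∈ G.verts | τ ≤ G.degree v}.card

/-- The number of nodes of degree exactly `j`: bin `j` of the degree histogram. -/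
def degreeBin (j : ℕ) (G : WGraph V) : ℕ := {v ∈ G.verts | G.degree v = j}.card

/-- The number of sets of three pairwise adjacent nodes. -/
def triangleCount (G : WGraph V) : ℕ :=
  {s ∈ G.verts.powersetCard 3 | ∀ a ∈ s, ∀ b ∈ s, a ≠ b → s(a, b) ∈ G.edges}.card

/-- The number of `k`-stars: a center `v` together with `k` distinct edges at `v`. -/
def kStarCount (k : ℕ) (G : WGraph V) : ℕ :=
  ∑ v ∈ G.verts, ((G.incident v).powersetCard k).card

/-- `F` is the edge set of a spanning forest of `G`: it is acyclic and connects any two nodes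
that are connected in `G`. If `G` is connected, this is a spanning tree. -/
def IsSpanningForest (G : WGraph V) (F : Finset (Sym2 V)) : Prop :=
  F ⊆ G.edges ∧
  (SimpleGraph.fromEdgeSet (F : Set (Sym2 V))).IsAcyclic ∧
  ∀ a b : V, (SimpleGraph.fromEdgeSet (G.edges : Set (Sym2 V))).Reachable a b →
    (SimpleGraph.fromEdgeSet (F : Set (Sym2 V))).Reachable a b

/-- The weight of a minimum spanning tree (of a minimum spanning forest if `G` is
disconnected). -/
noncomputable def mstWeight (G : WGraph V) : ℕ :=
  sInf {x : ℕ | ∃ F : Finset (Sym2 V), G.IsSpanningForest F ∧ ∑ e ∈ F, G.weight e = x}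

end WGraph

/-- A graph sequence of length `T`: an initial graph (index `0`) and `T` updates. The update with
index `i : Fin T` leads from the graph with index `i.castSucc` to the one with index `i.succ`, so
the sequence consists of the graphs with indices `i.succ`. Every edge has a fixed weight. -/
structure GraphSeq (V : Type u) [DecidableEq V] (T : ℕ) where
  verts : Fin (T + 1) → Finset V
  edges : Fin (T + 1) → Finset (Sym2 V)
  weight : Sym2 V → ℕ
  vIns : Fin T → Finset V
  vDel : Fin T → Finset V
  eIns : Fin T → Finset (Sym2 V)
  eDel : Fin T → Finset (Sym2 V)
  edges_zero : ∀ e ∈ edges 0, ¬ e.IsDiag ∧ ∀ v ∈ e, v ∈ verts 0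
  verts_succ : ∀ i, verts i.succ = (verts i.castSucc \ vDel i) ∪ vIns i
  edges_succ : ∀ i, edges i.succ = (edges i.castSucc \ eDel i) ∪ eIns i
  /-- all edges at a deleted node are deleted -/
  eDel_of_vDel : ∀ i, ∀ v ∈ vDel i, ∀ e ∈ edges i.castSucc, v ∈ e → e ∈ eDel i
  /-- inserted edges are not loops, and both endpoints are present -/
  eIns_valid : ∀ i, ∀ e ∈ eIns i, ¬ e.IsDiag ∧ ∀ v ∈ e, v ∈ verts i.succ

namespace GraphSeq

variable {V : Type u} [DecidableEq V] {T : ℕ}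

/-- The weighted graph with index `i`; weights off its edge set are set to `0`. -/
def graph (S : GraphSeq V T) (i : Fin (T + 1)) : WGraph V where
  verts := S.verts i
  edges := S.edges i
  weight := fun e => if e ∈ S.edges i then S.weight e else 0

def Incremental (S : GraphSeq V T) : Prop := ∀ i, S.eDel i = ∅ ∧ S.vDel i = ∅

def Decremental (S : GraphSeq V T) : Prop := ∀ i, S.eIns i = ∅ ∧ S.vIns i = ∅

def PartiallyDynamic (S : GraphSeq V T) : Prop := S.Incremental ∨ S.Decremental

/-- All graphs of the sequence have maximum degree at most `D`. -/
def DegreeLE (D : ℕ) (S : GraphSeq V T) : Prop :=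
  ∀ i : Fin T, ∀ v ∈ S.verts i.succ, (S.graph i.succ).degree v ≤ D

/-- All edge weights in the sequence are in `{1, …, W}`. -/
def WeightLE (W : ℕ) (S : GraphSeq V T) : Prop :=
  ∀ i : Fin T, ∀ e ∈ S.edges i.succ, 1 ≤ S.weight e ∧ S.weight e ≤ W

/-- `A'` arises from the sequence of sets `A` by leaving out the element `x` at one time. -/
def DropsOnce {α : Type u} [DecidableEq α] (x : α) (A A' : Fin T → Finset α) : Prop :=
  (∀ t, A' t ⊆ A t) ∧ ∃ s, A s \ A' s = {x} ∧ ∀ t, t ≠ s → A t = A' t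

/-- `S` and `S'` start with the same graph, and `S'` has the updates of `S` except for one
insertion or one deletion of the edge `x`. -/
def EdgeAdjOn (x : Sym2 V) (S S' : GraphSeq V T) : Prop :=
  S.graph 0 = S'.graph 0 ∧
  (∀ e, e ≠ x → S.weight e = S'.weight e) ∧
  S.vDel = S'.vDel ∧ S.vIns = S'.vIns ∧
  ((S.eDel = S'.eDel ∧ DropsOnce x S.eIns S'.eIns) ∨
   (S.eIns = S'.eIns ∧ DropsOnce x S.eDel S'.eDel))

/-- `S` and `S'` start with the same graph, and `S'` has the updates of `S` except for one
insertion or one deletion of the node `x` and for updates of edges incident to `x`. Edge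
updates of `S` only happen together with an insertion (deletion) of an endpoint.

This includes the case that the edge update sets of `S'` are those of `S` without the edges
incident to `x`. It also allows `S'` to delete an edge `s(x, y)` if it deletes `y` while keeping
`x`, as it must since `S'` is a graph sequence. -/
def NodeAdjOn (x : V) (S S' : GraphSeq V T) : Prop :=
  S.graph 0 = S'.graph 0 ∧
  (∀ e, x ∉ e → S.weight e = S'.weight e) ∧
  ((S.vDel = S'.vDel ∧ DropsOnce x S.vIns S'.vIns) ∨
   (S.vIns = S'.vIns ∧ DropsOnce x S.vDel S'.vDel)) ∧
  (∀ t, ∀ e ∈ S.eIns t, ∃ v ∈ S.vIns t, v ∈ e) ∧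
  (∀ t, ∀ e ∈ S.eDel t, ∃ v ∈ S.vDel t, v ∈ e) ∧
  (∀ t e, x ∉ e → (e ∈ S.eIns t ↔ e ∈ S'.eIns t)) ∧
  (∀ t e, x ∉ e → (e ∈ S.eDel t ↔ e ∈ S'.eDel t))

/-- Event-level edge-adjacency. -/
def EdgeAdj (S S' : GraphSeq V T) : Prop := ∃ x, EdgeAdjOn x S S' ∨ EdgeAdjOn x S' S

/-- Event-level node-adjacency. -/
def NodeAdj (S S' : GraphSeq V T) : Prop := ∃ x, NodeAdjOn x S S' ∨ NodeAdjOn x S' S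

end GraphSeq

section Mechanism

variable {V : Type u} [DecidableEq V] {T : ℕ} {ι : Type}

/-- A randomized dynamic algorithm for sequences of length `T`, given by the joint law of its
outputs: at each of the `T` time steps it outputs a real vector with index set `ι`. -/
abbrev Mechanism (V : Type u) [DecidableEq V] (T : ℕ) (ι : Type) :=
  GraphSeq V T → ProbabilityMeasure (Fin T → ι → ℝ)

/-- The outputs are released continually: the law of the outputs up to time `t` is determined by
the graphs up to time `t`. -/
def Mechanism.Online (A : Mechanism V T ι) (P : GraphSeq V T → Prop) : Prop :=
  ∀ S S', P S → P S' → ∀ t : Fin T, (∀ i ≤ t, S.graph i.succ = S'.graph i.succ) →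
    (A S : Measure (Fin T → ι → ℝ)).map (fun o (i : Set.Iic t) => o i) =
      (A S' : Measure (Fin T → ι → ℝ)).map (fun o (i : Set.Iic t) => o i)

/-- `ε`-differential privacy on the inputs in `P`, with respect to the adjacency relation `Adj`. -/
def Mechanism.Private (A : Mechanism V T ι) (P : GraphSeq V T → Prop)
    (Adj : GraphSeq V T → GraphSeq V T → Prop) (ε : ℝ) : Prop :=
  ∀ S S', P S → P S' → Adj S S' → ∀ B : Set (Fin T → ι → ℝ), MeasurableSet B →
    (A S : Measure (Fin T → ι → ℝ)) B ≤
      ENNReal.ofReal (Real.exp ε) * (A S' : Measure (Fin T → ι → ℝ)) B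

/-- On every input in `P`, at each time step each coordinate of the output differs from that of
the graph function `f` by at most `err`, with probability at least `1 - δ`. -/
def Mechanism.Accurate (A : Mechanism V T ι) (P : GraphSeq V T → Prop)
    (f : WGraph V → ι → ℝ) (δ err : ℝ) : Prop :=
  ∀ S, P S → ∀ (t : Fin T) (j : ι),
    ENNReal.ofReal (1 - δ) ≤
      (A S : Measure (Fin T → ι → ℝ)) {o | |o t j - f (S.graph t.succ) j| ≤ err}

/-- On the partially dynamic sequences with the property `Q`, there is a dynamic algorithm for `f`
that is `ε`-differentially private with respect to `Adj` and has additive error at most `err` with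
probability at least `1 - δ`. -/
def HasPrivateAlgorithm (Q : GraphSeq V T → Prop) (Adj : GraphSeq V T → GraphSeq V T → Prop)
    (f : WGraph V → ι → ℝ) (ε δ err : ℝ) : Prop :=
  ∃ A : Mechanism V T ι,
    A.Online (fun S => S.PartiallyDynamic ∧ Q S) ∧
    A.Private (fun S => S.PartiallyDynamic ∧ Q S) Adj ε ∧
    A.Accurate (fun S => S.PartiallyDynamic ∧ Q S) f δ err

/-- A real-valued graph function as a function with a single output coordinate. -/
def scalar (f : WGraph V → ℕ) : WGraph V → Unit → ℝ := fun G _ => (f G : ℝ)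

/-- The degree histogram of a graph of maximum degree at most `D`. -/
def degreeHistogram (D : ℕ) : WGraph V → Fin (D + 1) → ℝ := fun G j => (G.degreeBin j : ℝ)

/-- The factor `log^{3/2} T · Λ` with `Λ = log (1 / δ) / ε` that all error bounds share. -/
noncomputable def baseError (T : ℕ) (ε δ : ℝ) : ℝ :=
  (Real.log T) ^ (3 / 2 : ℝ) * (Real.log (1 / δ) / ε)

end Mechanism

/-!
Every prefix of the time axis is a disjoint union of at most `log₂ T + 1` dyadic blocks. Release the
increment of `f` over each dyadic block with independent Laplace noise, and answer at time `t` with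
the sum over the blocks of the prefix. The blocks of one level partition the time axis, so the
increments of two input sequences differ in total by at most the number of levels times the total
variation of the difference of the two value sequences. If this variation is at most `Γ` on adjacent
inputs, then noise of scale `Γ log T / ε` suffices, and the noise variables of a prefix add up to an
error of order `Γ (log T)^{3/2} log (1/δ) / ε`. A common uniform shift of all outputs ensures this
bound also for `δ` close to `1`, where `log (1/δ)` is small.

Two adjacent inputs coincide once the edge or the node in question is erased from both, so each is
compared with itself without that edge or node. For a counting function, the contribution of an
edge is a combination of products of bounded sequences that are monotone because the graphs only
grow or only shrink, and such products have bounded variation. A node of degree at most `D` amounts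
to `D` edges and an isolated node. The weight of a minimum spanning forest is, by Kruskal's
algorithm, `∑_{i < W} (rank E - rank E_{≤ i})` with the graphic rank, and the marginal rank of an
edge is a product of two monotone indicators: that the edge is present, and that its endpoints are
not connected without it.
-/

/-! ### Variation of real sequences -/

/-- The sequence `h` has total variation at most `B` when it is started from the value `0`, so
that the jump from `0` to `h 0` counts as well. -/
def VariationLE (h : ℕ → ℝ) (B : ℝ) : Prop :=
  ∀ N, |h 0| + ∑ i ∈ Finset.range N, |h (i + 1) - h i| ≤ B

namespace VariationLE

variable {a b : ℕ → ℝ} {A B : ℝ}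

theorem mono (ha : VariationLE a A) (h : A ≤ B) : VariationLE a B := fun N => (ha N).trans h

theorem zero : VariationLE (fun _ => 0) 0 := fun N => by simp

theorem add (ha : VariationLE a A) (hb : VariationLE b B) :
    VariationLE (fun t => a t + b t) (A + B) := fun N => by
  have hsum : ∑ i ∈ Finset.range N, |a (i + 1) + b (i + 1) - (a i + b i)| ≤
      ∑ i ∈ Finset.range N, |a (i + 1) - a i| + ∑ i ∈ Finset.range N, |b (i + 1) - b i| := by
    rw [← Finset.sum_add_distrib]
    refine Finset.sum_le_sum fun i _ => ?_
    rw [add_sub_add_comm]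
    exact abs_add_le _ _
  linarith [ha N, hb N, abs_add_le (a 0) (b 0)]

theorem neg (ha : VariationLE a A) : VariationLE (fun t => -a t) A := fun N => by
  simpa only [abs_neg, neg_sub_neg, abs_sub_comm (a _) (a (_ + 1))] using ha N

theorem sub (ha : VariationLE a A) (hb : VariationLE b B) :
    VariationLE (fun t => a t - b t) (A + B) := by
  simpa only [sub_eq_add_neg] using ha.add hb.neg

theorem sum {κ : Type*} (s : Finset κ) {g : κ → ℕ → ℝ} {C : κ → ℝ}
    (h : ∀ i ∈ s, VariationLE (g i) (C i)) :
    VariationLE (fun t => ∑ i ∈ s, g i t) (∑ i ∈ s, C i) := by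
  classical
  induction s using Finset.induction_on with
  | empty => simpa using zero
  | insert i s hi ih =>
    simp only [Finset.sum_insert hi]
    exact (h i (by simp)).add (ih fun j hj => h j (by simp [hj]))

theorem mul {α β : ℝ} (ha : VariationLE a A) (hb : VariationLE b B) (hα : ∀ t, |a t| ≤ α)
    (hβ : ∀ t, |b t| ≤ β) : VariationLE (fun t => a t * b t) (A * β + α * B) := fun N => by
  have hα0 : 0 ≤ α := (abs_nonneg _).trans (hα 0)
  have hβ0 : 0 ≤ β := (abs_nonneg _).trans (hβ 0)
  have hstep (i : ℕ) : |a (i + 1) * b (i + 1) - a i * b i| ≤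
      |a (i + 1) - a i| * β + α * |b (i + 1) - b i| := by
    rw [show a (i + 1) * b (i + 1) - a i * b i =
      (a (i + 1) - a i) * b (i + 1) + a i * (b (i + 1) - b i) by ring]
    refine (abs_add_le _ _).trans ?_
    rw [abs_mul, abs_mul]
    gcongr
    exacts [hβ _, hα _]
  have hsum := Finset.sum_le_sum fun i (_ : i ∈ Finset.range N) => hstep i
  rw [Finset.sum_add_distrib, ← Finset.sum_mul, ← Finset.mul_sum] at hsum
  have hzero : |a 0 * b 0| ≤ |a 0| * β := by
    rw [abs_mul]
    gcongr
    exact hβ 0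
  linarith [mul_le_mul_of_nonneg_right (ha N) hβ0, mul_le_mul_of_nonneg_left (hb N) hα0,
    mul_nonneg hα0 (abs_nonneg (b 0))]

theorem of_monotone_or_antitone (h : Monotone a ∨ Antitone a) (h0 : ∀ t, 0 ≤ a t)
    (hA : ∀ t, a t ≤ A) : VariationLE a (2 * A) := fun N => by
  have htelescope : ∑ i ∈ Finset.range N, |a (i + 1) - a i| ≤ |a N - a 0| := by
    rcases h with h | h
    · rw [Finset.sum_congr rfl fun i _ => abs_of_nonneg (sub_nonneg.2 (h i.le_succ)),
        Finset.sum_range_sub]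
      exact le_abs_self _
    · rw [Finset.sum_congr rfl fun i _ => abs_of_nonpos (sub_nonpos.2 (h i.le_succ)),
        Finset.sum_neg_distrib, Finset.sum_range_sub]
      exact neg_le_abs _
  have hdiff : |a N - a 0| ≤ A := abs_le.2 ⟨by linarith [h0 N, hA 0], by linarith [h0 0, hA N]⟩
  rw [abs_of_nonneg (h0 0)]
  linarith [hA 0]

theorem indicator {p : ℕ → Prop} [DecidablePred p] (h : Monotone p ∨ Antitone p) :
    VariationLE (fun t => if p t then 1 else 0) 2 := by
  rw [← mul_one (2 : ℝ)]
  refine of_monotone_or_antitone (h.imp ?_ ?_) (fun t => by split_ifs <;> simp)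
    fun t => by split_ifs <;> simp
  all_goals
    intro h s t hst
    have := h hst
    dsimp only
    split_ifs with hs ht <;> simp
    tauto

end VariationLE

/-! ### Laplace noise -/

section Laplace

theorem integrable_exp_mul_sub_abs {s : ℝ} (hs : |s| < 1) :
    Integrable fun x : ℝ => Real.exp (s * x - |x|) := by
  obtain ⟨hs_gt, hs_lt⟩ := abs_lt.1 hs
  rw [← integrableOn_univ, ← Set.Iic_union_Ioi (a := (0 : ℝ)), integrableOn_union]
  constructor
  · refine (integrableOn_exp_mul_Iic (a := s + 1) (by linarith) 0).congr_fun (fun x hx => ?_)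
      measurableSet_Iic
    simp only [abs_of_nonpos (Set.mem_Iic.1 hx)]
    ring_nf
  · refine (integrableOn_exp_mul_Ioi (a := s - 1) (by linarith) 0).congr_fun (fun x hx => ?_)
      measurableSet_Ioi
    simp only [abs_of_pos (Set.mem_Ioi.1 hx)]
    ring_nf

theorem integral_exp_mul_sub_abs {s : ℝ} (hs : |s| < 1) :
    ∫ x : ℝ, Real.exp (s * x - |x|) = 2 / (1 - s ^ 2) := by
  obtain ⟨hs_gt, hs_lt⟩ := abs_lt.1 hs
  have hint := integrable_exp_mul_sub_abs hs
  have hneg : ∫ x in Set.Iic 0, Real.exp (s * x - |x|) = 1 / (s + 1) := by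
    rw [setIntegral_congr_fun (g := fun x => Real.exp ((s + 1) * x)) measurableSet_Iic
      fun x hx => by simp only [abs_of_nonpos (Set.mem_Iic.1 hx)]; ring_nf,
      integral_exp_mul_Iic (by linarith), mul_zero, Real.exp_zero]
  have hpos : ∫ x in Set.Ioi 0, Real.exp (s * x - |x|) = -1 / (s - 1) := by
    rw [setIntegral_congr_fun (g := fun x => Real.exp ((s - 1) * x)) measurableSet_Ioi
      fun x hx => by simp only [abs_of_pos (Set.mem_Ioi.1 hx)]; ring_nf,
      integral_exp_mul_Ioi (by linarith), mul_zero, Real.exp_zero]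
  rw [← setIntegral_univ, ← Set.Iic_union_Ioi (a := (0 : ℝ)),
    setIntegral_union (Set.Iic_disjoint_Ioi le_rfl) measurableSet_Ioi hint.integrableOn
      hint.integrableOn, hneg, hpos]
  have hadd : s + 1 ≠ 0 := by linarith
  have hsub : s - 1 ≠ 0 := by linarith
  rw [show 1 - s ^ 2 = -((s + 1) * (s - 1)) by ring]
  field_simp
  ring

/-- The law of a vector of independent Laplace variables of scale `1`, given by its joint
density. -/
noncomputable def laplaceNoise (K : Type*) [Fintype K] : Measure (K → ℝ) :=
  volume.withDensity fun z => ENNReal.ofReal (∏ k, (1 / 2 * Real.exp (-|z k|)))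

variable {K : Type*} [Fintype K]

theorem lintegral_exp_laplaceNoise (c : K → ℝ) (hc : ∀ k, |c k| < 1) :
    ∫⁻ z, ENNReal.ofReal (Real.exp (∑ k, c k * z k)) ∂laplaceNoise K =
      ENNReal.ofReal (∏ k, (1 / (1 - c k ^ 2))) := by
  rw [laplaceNoise, lintegral_withDensity_eq_lintegral_mul _ (by fun_prop) (by fun_prop)]
  have htilt (z : K → ℝ) : ((fun z : K → ℝ => ENNReal.ofReal (∏ k, (1 / 2 * Real.exp (-|z k|)))) *
      fun z : K → ℝ => ENNReal.ofReal (Real.exp (∑ k, c k * z k))) z =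
      ENNReal.ofReal (∏ k, (1 / 2 * Real.exp (c k * z k - |z k|))) := by
    rw [Pi.mul_apply, ← ENNReal.ofReal_mul (by positivity), Real.exp_sum,
      ← Finset.prod_mul_distrib]
    congr! 2 with k
    rw [mul_assoc, ← Real.exp_add]
    ring_nf
  have hint : Integrable (fun z : K → ℝ => ∏ k, (1 / 2 * Real.exp (c k * z k - |z k|))) volume :=
    Integrable.fintype_prod_dep (f := fun k x => 1 / 2 * Real.exp (c k * x - |x|))
      fun k => (integrable_exp_mul_sub_abs (hc k)).const_mul (1 / 2)
  simp_rw [htilt]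
  rw [← ofReal_integral_eq_lintegral_ofReal hint (.of_forall fun z => by positivity),
    integral_fintype_prod_volume_eq_prod (f := fun k x => 1 / 2 * Real.exp (c k * x - |x|))]
  congr! 2 with k
  rw [integral_const_mul, integral_exp_mul_sub_abs (hc k)]
  ring

instance : IsProbabilityMeasure (laplaceNoise K) :=
  ⟨by simpa using lintegral_exp_laplaceNoise (K := K) (fun _ => 0) (by simp)⟩

theorem laplaceNoise_preimage_add_le (a : K → ℝ) {A : Set (K → ℝ)} (hA : MeasurableSet A) :
    laplaceNoise K ((fun z => z + a) ⁻¹' A) ≤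
      ENNReal.ofReal (Real.exp (∑ k, |a k|)) * laplaceNoise K A := by
  have hA' : MeasurableSet ((fun z => z + a) ⁻¹' A) := hA.preimage (by fun_prop)
  rw [laplaceNoise, withDensity_apply _ hA, withDensity_apply _ hA', ← lintegral_indicator hA,
    ← lintegral_indicator hA', ← lintegral_const_mul _ (Measurable.indicator (by fun_prop) hA),
    ← lintegral_add_right_eq_self (fun z => ENNReal.ofReal (Real.exp (∑ k, |a k|)) * _) a]
  refine lintegral_mono fun z => ?_
  by_cases hz : z + a ∈ A
  · rw [Set.indicator_of_mem (s := (fun z => z + a) ⁻¹' A) hz, Set.indicator_of_mem hz,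
      ← ENNReal.ofReal_mul (by positivity), Real.exp_sum, ← Finset.prod_mul_distrib]
    refine ENNReal.ofReal_le_ofReal (Finset.prod_le_prod (fun _ _ => by positivity) fun k _ => ?_)
    rw [mul_left_comm, ← Real.exp_add, Pi.add_apply]
    gcongr
    linarith [add_sub_cancel_left (z k) (a k) ▸ abs_sub_abs_le_abs_sub (z k + a k) (z k)]
  · rw [Set.indicator_of_notMem (s := (fun z => z + a) ⁻¹' A) hz]
    exact zero_le

theorem one_div_one_sub_le_exp_two_mul {x : ℝ} (h0 : 0 ≤ x) (h1 : x ≤ 1 / 2) :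
    1 / (1 - x) ≤ Real.exp (2 * x) := by
  rw [div_le_iff₀ (by linarith)]
  nlinarith [Real.add_one_le_exp (2 * x)]

theorem lintegral_exp_mul_sum_laplaceNoise_le (s : Finset K) {r : ℝ} (hr : r ^ 2 ≤ 1 / 2) :
    ∫⁻ z, ENNReal.ofReal (Real.exp (r * ∑ k ∈ s, z k)) ∂laplaceNoise K ≤
      ENNReal.ofReal (Real.exp (2 * s.card * r ^ 2)) := by
  classical
  have hr_abs : |r| < 1 := (sq_lt_one_iff_abs_lt_one r).1 (by linarith)
  have hmgf := lintegral_exp_laplaceNoise (fun k => if k ∈ s then r else 0)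
    fun k => by split_ifs <;> simp [hr_abs]
  have hexponent (z : K → ℝ) : ∑ k, (if k ∈ s then r else 0) * z k = r * ∑ k ∈ s, z k := by
    simp [Finset.mul_sum, ite_mul, Finset.sum_ite_mem]
  have hfactor (k : K) : 1 / (1 - (if k ∈ s then r else 0) ^ 2) =
      if k ∈ s then 1 / (1 - r ^ 2) else 1 := by split_ifs <;> simp
  simp_rw [hexponent, hfactor, Finset.prod_ite_mem, Finset.univ_inter, Finset.prod_const] at hmgf
  rw [hmgf]
  refine ENNReal.ofReal_le_ofReal ?_
  calc (1 / (1 - r ^ 2)) ^ s.card ≤ Real.exp (2 * r ^ 2) ^ s.card :=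
        pow_le_pow_left₀ (div_nonneg zero_le_one (by linarith))
          (one_div_one_sub_le_exp_two_mul (sq_nonneg r) hr) _
    _ = Real.exp (2 * s.card * r ^ 2) := by
        rw [← Real.exp_nat_mul]
        ring_nf

theorem lintegral_exp_mul_abs_sum_laplaceNoise_le (s : Finset K) {r : ℝ} (h0 : 0 ≤ r)
    (hr : r ^ 2 ≤ 1 / 2) :
    ∫⁻ z, ENNReal.ofReal (Real.exp (r * |∑ k ∈ s, z k|)) ∂laplaceNoise K ≤
      ENNReal.ofReal (2 * Real.exp (2 * s.card * r ^ 2)) := by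
  calc ∫⁻ z, ENNReal.ofReal (Real.exp (r * |∑ k ∈ s, z k|)) ∂laplaceNoise K
      ≤ ∫⁻ z, (ENNReal.ofReal (Real.exp (r * ∑ k ∈ s, z k)) +
          ENNReal.ofReal (Real.exp (-r * ∑ k ∈ s, z k))) ∂laplaceNoise K := by
        refine lintegral_mono fun z => ?_
        rw [← ENNReal.ofReal_add (by positivity) (by positivity), neg_mul]
        refine ENNReal.ofReal_le_ofReal ?_
        simpa [abs_mul, abs_of_nonneg h0] using Real.exp_abs_le (r * ∑ k ∈ s, z k)
    _ ≤ ENNReal.ofReal (Real.exp (2 * s.card * r ^ 2)) +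
          ENNReal.ofReal (Real.exp (2 * s.card * r ^ 2)) := by
        rw [lintegral_add_left (by fun_prop)]
        refine add_le_add (lintegral_exp_mul_sum_laplaceNoise_le s hr) ?_
        simpa only [neg_sq] using
          lintegral_exp_mul_sum_laplaceNoise_le s (r := -r) (by rwa [neg_sq])
    _ = ENNReal.ofReal (2 * Real.exp (2 * s.card * r ^ 2)) := by
        rw [← ENNReal.ofReal_add (by positivity) (by positivity), two_mul (Real.exp _)]

theorem laplaceNoise_lt_abs_sum_le (s : Finset K) (y : ℝ) :
    laplaceNoise K {z | √(2 * s.card) * y < |∑ k ∈ s, z k|} ≤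
      ENNReal.ofReal (2 * Real.exp (1 - y)) := by
  rcases s.eq_empty_or_nonempty with rfl | hs
  · simp
  have hcard : (1 : ℝ) ≤ s.card := by exact_mod_cast hs.card_pos
  have hw : 0 < √(2 * s.card) := by positivity
  have hr : (√(2 * s.card))⁻¹ ^ 2 = (2 * (s.card : ℝ))⁻¹ := by
    rw [inv_pow, Real.sq_sqrt (by positivity)]
  have hmgf := lintegral_exp_mul_abs_sum_laplaceNoise_le s (inv_nonneg.2 hw.le)
    (by rw [hr, one_div]; gcongr; linarith)
  rw [hr, mul_inv_cancel₀ (by positivity)] at hmgf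
  calc laplaceNoise K {z | √(2 * s.card) * y < |∑ k ∈ s, z k|}
      ≤ laplaceNoise K {z | ENNReal.ofReal (Real.exp y) ≤
          ENNReal.ofReal (Real.exp ((√(2 * s.card))⁻¹ * |∑ k ∈ s, z k|))} := by
        refine measure_mono fun z (hz : √(2 * s.card) * y < _) =>
          ENNReal.ofReal_le_ofReal (Real.exp_le_exp.2 ?_)
        rw [← div_eq_inv_mul, le_div_iff₀ hw]
        linarith
    _ ≤ _ := meas_ge_le_lintegral_div (by fun_prop) (by simp [Real.exp_pos]) (by simp)
    _ ≤ ENNReal.ofReal (2 * Real.exp 1) / ENNReal.ofReal (Real.exp y) := by gcongr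
    _ = ENNReal.ofReal (2 * Real.exp (1 - y)) := by
        rw [← ENNReal.ofReal_div_of_pos (Real.exp_pos _), mul_div_assoc, ← Real.exp_sub]

theorem le_laplaceNoise_abs_sum_le (s : Finset K) (y : ℝ) :
    ENNReal.ofReal (1 - 2 * Real.exp (1 - y)) ≤
      laplaceNoise K {z | |∑ k ∈ s, z k| ≤ √(2 * s.card) * y} := by
  rw [ENNReal.ofReal_sub _ (by positivity), ENNReal.ofReal_one,
    ← compl_compl {z : K → ℝ | |∑ k ∈ s, z k| ≤ √(2 * s.card) * y},
    prob_compl_eq_one_sub (measurableSet_le (by fun_prop) (by fun_prop)).compl,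
    show {z : K → ℝ | |∑ k ∈ s, z k| ≤ √(2 * s.card) * y}ᶜ =
      {z | √(2 * s.card) * y < |∑ k ∈ s, z k|} by ext; simp]
  exact tsub_le_tsub_left (laplaceNoise_lt_abs_sum_le s y) _

end Laplace

/-! ### Dyadic decomposition of prefixes -/

section Dyadic

variable {ι : Type*} (n T : ℕ)

/-- The dyadic blocks, for each output coordinate: `(l, q, j)` stands for the `q`-th block of
level `l`. -/
abbrev DyadicIndex (ι : Type*) := Fin n × Fin (T + 1) × ι

/-- The blocks, one on each level, whose increments add up to the prefix ending with time step
`t`. They correspond to the binary digits of `t + 1`. -/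
def dyadicPath (t : Fin T) (j : ι) (l : Fin n) : DyadicIndex n T ι :=
  (l, ⟨(t + 1) / 2 ^ (l : ℕ), Nat.lt_succ_of_le ((Nat.div_le_self _ _).trans t.2)⟩, j)

/-- The increment of `F` on a dyadic block. It runs from the next multiple of `2 ^ (l + 1)` below
`q * 2 ^ l` to `q * 2 ^ l`, so blocks with even `q` are empty. -/
def dyadicIncrement (F : ℕ → ι → ℝ) (k : DyadicIndex n T ι) : ℝ :=
  F (k.2.1 * 2 ^ (k.1 : ℕ)) k.2.2 - F (k.2.1 / 2 * 2 ^ (k.1 + 1 : ℕ)) k.2.2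

variable {n T}

theorem dyadicPath_injective (t : Fin T) (j : ι) : Function.Injective (dyadicPath n T t j) :=
  fun _ _ h => congrArg Prod.fst h

theorem sum_dyadicIncrement (F : ℕ → ι → ℝ) (hT : T < 2 ^ n) (t : Fin T) (j : ι) :
    ∑ l, dyadicIncrement n T F (dyadicPath n T t j l) = F (t + 1) j - F 0 j := by
  simp only [dyadicIncrement, dyadicPath, Nat.div_div_eq_div_mul, ← pow_succ]
  rw [Fin.sum_univ_eq_sum_range (fun l => F ((t + 1) / 2 ^ l * 2 ^ l) j -
    F ((t + 1) / 2 ^ (l + 1) * 2 ^ (l + 1)) j), Finset.sum_range_sub',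
    Nat.div_eq_of_lt (b := 2 ^ n) (by omega)]
  simp

theorem sum_abs_sub_block_le (g : ℕ → ℝ) (m N : ℕ) :
    ∑ q ∈ Finset.range N, |g ((q + 1) * m) - g (q * m)| ≤
      ∑ i ∈ Finset.range (N * m), |g (i + 1) - g i| := by
  induction N with
  | zero => simp
  | succ N ih =>
    rw [Finset.sum_range_succ, Nat.succ_mul, Finset.sum_range_add]
    refine add_le_add ih ?_
    have htelescope := Finset.sum_range_sub (fun i => g (N * m + i)) m
    rw [add_zero] at htelescope
    rw [← htelescope]
    exact Finset.abs_sum_le_sum_abs _ _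

theorem abs_dyadicIncrement_succ_le (g : ℕ → ℝ) (l q : ℕ) :
    |g ((q + 1) * 2 ^ l) - g ((q + 1) / 2 * 2 ^ (l + 1))| ≤
      |g ((q + 1) * 2 ^ l) - g (q * 2 ^ l)| := by
  rcases Nat.even_or_odd' q with ⟨c, rfl | rfl⟩
  · rw [show (2 * c + 1) / 2 * 2 ^ (l + 1) = 2 * c * 2 ^ l by
      rw [show (2 * c + 1) / 2 = c by omega]; ring]
  · rw [show (2 * c + 1 + 1) / 2 * 2 ^ (l + 1) = (2 * c + 1 + 1) * 2 ^ l by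
      rw [show (2 * c + 1 + 1) / 2 = c + 1 by omega]; ring, sub_self, abs_zero]
    exact abs_nonneg _

theorem sum_abs_dyadicIncrement_level_le {F : ℕ → ι → ℝ} {j : ι} {B : ℝ}
    (hB : ∀ N, ∑ i ∈ Finset.range N, |F (i + 1) j - F i j| ≤ B) (l : Fin n) :
    ∑ q : Fin (T + 1), |dyadicIncrement n T F (l, q, j)| ≤ B := by
  simp only [dyadicIncrement]
  rw [Fin.sum_univ_eq_sum_range (fun q => |F (q * 2 ^ (l : ℕ)) j -
    F (q / 2 * 2 ^ (l + 1 : ℕ)) j|), Finset.sum_range_succ']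
  simp only [zero_mul, Nat.zero_div, sub_self, abs_zero, add_zero]
  exact (Finset.sum_le_sum fun q _ => abs_dyadicIncrement_succ_le (F · j) l q).trans
    ((sum_abs_sub_block_le (F · j) (2 ^ (l : ℕ)) T).trans (hB _))

theorem sum_abs_dyadicIncrement_le [Fintype ι] {F : ℕ → ι → ℝ} {B : ι → ℝ}
    (hB : ∀ j N, ∑ i ∈ Finset.range N, |F (i + 1) j - F i j| ≤ B j) :
    ∑ k, |dyadicIncrement n T F k| ≤ n * ∑ j, B j := by
  rw [Fintype.sum_prod_type]
  refine (Finset.sum_le_sum (g := fun _ => ∑ j, B j) fun l _ => ?_).trans (by simp)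
  rw [Fintype.sum_prod_type, Finset.sum_comm]
  exact Finset.sum_le_sum fun j _ => sum_abs_dyadicIncrement_level_le (hB j) l

end Dyadic

/-! ### Noise of the tree mechanism -/

section TreeNoise

/-- The uniform distribution on `[-1, 1]`. -/
noncomputable def uniformNoise : Measure ℝ := ProbabilityTheory.cond volume (Set.Icc (-1) 1)

instance : IsProbabilityMeasure uniformNoise :=
  ProbabilityTheory.cond_isProbabilityMeasure_of_finite (by simp) (by simp)

theorem uniformNoise_Icc : uniformNoise (Set.Icc (-1) 1) = 1 :=
  ProbabilityTheory.cond_apply_self (by simp) (by simp)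

theorem uniformNoise_abs_add_mul_le {M x r : ℝ} (hM : 0 < M) (h : |x| + r ≤ M) :
    uniformNoise {u | |x + M * u| ≤ r} = ENNReal.ofReal (r / M) := by
  have hset : Set.Icc (-1) 1 ∩ {u : ℝ | |x + M * u| ≤ r} =
      Set.Icc ((-x - r) / M) ((-x + r) / M) := by
    ext u
    simp only [Set.mem_inter_iff, Set.mem_Icc, Set.mem_ofPred_eq, abs_le, div_le_iff₀ hM,
      le_div_iff₀ hM]
    constructor
    · rintro ⟨-, _, _⟩
      constructor <;> linarith
    · rintro ⟨_, _⟩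
      refine ⟨⟨?_, ?_⟩, ?_, ?_⟩ <;> nlinarith [le_abs_self x, neg_abs_le x]
  rw [uniformNoise, ProbabilityTheory.cond_apply measurableSet_Icc, hset, Real.volume_Icc,
    Real.volume_Icc, ← ENNReal.ofReal_inv_of_pos (by norm_num),
    ← ENNReal.ofReal_mul (by norm_num)]
  congr 1
  ring

variable {n T : ℕ} {ι : Type*}

/-- The joint law of the noise of the tree mechanism: a Laplace variable for each dyadic block, and
a uniform variable for a common shift of all outputs. -/
noncomputable def treeNoise (n T : ℕ) (ι : Type*) [Fintype ι] :
    Measure ((DyadicIndex n T ι → ℝ) × ℝ) :=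
  (laplaceNoise (DyadicIndex n T ι)).prod uniformNoise

instance [Fintype ι] : IsProbabilityMeasure (treeNoise n T ι) := by
  unfold treeNoise
  infer_instance

/-- The noise in coordinate `j` of the output at time step `t`, before scaling. The Laplace
variables of the prefix add up to something of order `√n`. The uniform shift of the same order
gives the noise a density that is bounded below near `0`; it is what makes the error proportional
to `log (1 / δ)` even as `δ` tends to `1`. -/
noncomputable def prefixNoise (t : Fin T) (j : ι) (w : (DyadicIndex n T ι → ℝ) × ℝ) : ℝ :=
  ∑ l, w.1 (dyadicPath n T t j l) + 6 * √(2 * n) * w.2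

@[fun_prop]
theorem measurable_prefixNoise (t : Fin T) (j : ι) :
    Measurable (prefixNoise (n := n) t j) := by
  unfold prefixNoise
  fun_prop

variable [Fintype ι]

theorem le_laplaceNoise_abs_sum_dyadicPath_le (t : Fin T) (j : ι) (y : ℝ) :
    ENNReal.ofReal (1 - 2 * Real.exp (1 - y)) ≤ laplaceNoise (DyadicIndex n T ι)
      {z | |∑ l, z (dyadicPath n T t j l)| ≤ √(2 * n) * y} := by
  simpa using
    le_laplaceNoise_abs_sum_le (Finset.univ.map ⟨_, dyadicPath_injective (n := n) t j⟩) y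

theorem le_treeNoise_abs_prefixNoise_le_add_six (t : Fin T) (j : ι) (y : ℝ) :
    ENNReal.ofReal (1 - 2 * Real.exp (1 - y)) ≤
      treeNoise n T ι {w | |prefixNoise t j w| ≤ √(2 * n) * (y + 6)} := by
  refine (le_laplaceNoise_abs_sum_dyadicPath_le (n := n) t j y).trans ?_
  rw [← mul_one (laplaceNoise _ _), ← uniformNoise_Icc, ← Measure.prod_prod]
  refine measure_mono ?_
  rintro ⟨z, u⟩ ⟨hz : |∑ l, z (dyadicPath n T t j l)| ≤ _, hu⟩
  calc |prefixNoise t j (z, u)|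
      ≤ |∑ l, z (dyadicPath n T t j l)| + |6 * √(2 * n) * u| := abs_add_le _ _
    _ ≤ √(2 * n) * y + 6 * √(2 * n) * 1 := by
        rw [abs_mul, abs_of_nonneg (by positivity : 0 ≤ 6 * √(2 * (n : ℝ)))]
        gcongr
        exact abs_le.2 hu
    _ = √(2 * n) * (y + 6) := by ring

theorem mul_measure_le_prod_of_forall_le {α β : Type*} [MeasurableSpace α] [MeasurableSpace β]
    {μ : Measure α} {ν : Measure β} [SFinite ν] {A : Set α} {E : Set (α × β)}
    (hA : MeasurableSet A) (hE : MeasurableSet E) {q : ENNReal}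
    (h : ∀ x ∈ A, q ≤ ν (Prod.mk x ⁻¹' E)) : q * μ A ≤ μ.prod ν E :=
  calc q * μ A = ∫⁻ _ in A, q ∂μ := (setLIntegral_const A q).symm
    _ ≤ ∫⁻ x in A, ν (Prod.mk x ⁻¹' E) ∂μ := setLIntegral_mono' hA h
    _ ≤ ∫⁻ x, ν (Prod.mk x ⁻¹' E) ∂μ := setLIntegral_le_lintegral _ _
    _ = μ.prod ν E := (Measure.prod_apply hE).symm

theorem le_treeNoise_abs_prefixNoise_le_mul (hn : 0 < n) (t : Fin T) (j : ι) {p : ℝ}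
    (hp : 0 ≤ p) (hp' : p ≤ 1 / 4) :
    ENNReal.ofReal p ≤ treeNoise n T ι {w | |prefixNoise t j w| ≤ 12 * p * √(2 * n)} := by
  have hσ : 0 < √(2 * (n : ℝ)) := by positivity
  have hhalf : 1 / 2 ≤ 1 - 2 * Real.exp (1 - 3) := by
    suffices Real.exp (1 - 3) ≤ 1 / 4 by linarith
    rw [show (1 - 3 : ℝ) = -(1 + 1) by norm_num, Real.exp_neg, Real.exp_add,
      inv_le_comm₀ (by positivity) (by norm_num)]
    nlinarith [Real.add_one_le_exp 1]
  calc ENNReal.ofReal p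
      ≤ ENNReal.ofReal (2 * p) * ENNReal.ofReal (1 - 2 * Real.exp (1 - 3)) := by
        rw [← ENNReal.ofReal_mul (by positivity)]
        refine ENNReal.ofReal_le_ofReal ?_
        calc p = 2 * p * (1 / 2) := by ring
          _ ≤ 2 * p * (1 - 2 * Real.exp (1 - 3)) := by gcongr
    _ ≤ ENNReal.ofReal (2 * p) * laplaceNoise (DyadicIndex n T ι)
          {z | |∑ l, z (dyadicPath n T t j l)| ≤ √(2 * n) * 3} := by
        gcongr
        exact le_laplaceNoise_abs_sum_dyadicPath_le t j 3
    _ ≤ treeNoise n T ι {w | |prefixNoise t j w| ≤ 12 * p * √(2 * n)} := by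
        refine mul_measure_le_prod_of_forall_le (measurableSet_le (by fun_prop) (by fun_prop))
          (measurableSet_le (by fun_prop) (by fun_prop)) fun z hz => ?_
        rw [Set.mem_ofPred_eq] at hz
        have huniform := uniformNoise_abs_add_mul_le (M := 6 * √(2 * n))
          (x := ∑ l, z (dyadicPath n T t j l)) (r := 12 * p * √(2 * n)) (by positivity)
          (by nlinarith)
        rw [show 12 * p * √(2 * n) / (6 * √(2 * n)) = 2 * p by field_simp; ring] at huniform
        exact huniform.ge

theorem le_treeNoise_abs_prefixNoise_le_log (hn : 0 < n) (t : Fin T) (j : ι) {δ : ℝ} (hδ : 0 < δ)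
    (hδ1 : δ ≤ 1) : ENNReal.ofReal (1 - δ) ≤
      treeNoise n T ι {w | |prefixNoise t j w| ≤ 33 * √(2 * n) * Real.log (1 / δ)} := by
  have hlog : 1 - δ ≤ Real.log (1 / δ) := by
    rw [one_div, Real.log_inv]
    linarith [Real.log_le_sub_one_of_pos hδ]
  have hσ : 0 ≤ √(2 * (n : ℝ)) := Real.sqrt_nonneg _
  rcases le_or_gt δ (3 / 4) with hδ' | hδ'
  · refine le_trans (ENNReal.ofReal_le_ofReal ?_)
      ((le_treeNoise_abs_prefixNoise_le_add_six t j (Real.log (1 / δ) + 2)).trans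
        (measure_mono <| Set.ofPred_subset_ofPred.2 fun w hw => hw.trans ?_))
    · have hexp : Real.exp (1 - (Real.log (1 / δ) + 2)) = δ / Real.exp 1 := by
        rw [show 1 - (Real.log (1 / δ) + 2) = Real.log δ - 1 by
          rw [one_div, Real.log_inv]; ring, Real.exp_sub, Real.exp_log hδ]
      have hδe : δ / Real.exp 1 ≤ δ / 2 := by
        gcongr
        linarith [Real.add_one_le_exp 1]
      linarith
    · nlinarith
  · refine (le_treeNoise_abs_prefixNoise_le_mul hn t j (by linarith) (by linarith)).trans
      (measure_mono <| Set.ofPred_subset_ofPred.2 fun w hw => hw.trans ?_)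
    nlinarith

end TreeNoise

/-! ### The tree mechanism -/

section TreeMechanism

section Output

variable {ι : Type*} {n T : ℕ} {b : ℝ}

/-- The output of the tree mechanism with noise level `b` for the values `F 1, …, F T`, at the
noise values `w`. -/
noncomputable def treeOutput (n : ℕ) (b : ℝ) (F : ℕ → ι → ℝ)
    (w : (DyadicIndex n T ι → ℝ) × ℝ) : Fin T → ι → ℝ :=
  fun t j => F (t + 1) j + b * prefixNoise t j w

@[fun_prop]
theorem measurable_treeOutput (F : ℕ → ι → ℝ) : Measurable (treeOutput (T := T) n b F) := by
  unfold treeOutput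
  fun_prop

theorem treeOutput_eq_add_dyadicIncrement (hb : b ≠ 0) (hT : T < 2 ^ n) {F F' : ℕ → ι → ℝ}
    (h0 : F 0 = F' 0) (z : DyadicIndex n T ι → ℝ) (u : ℝ) :
    treeOutput n b F (z, u) =
      treeOutput n b F' (z + fun k => b⁻¹ * dyadicIncrement n T (F - F') k, u) := by
  funext t j
  simp only [treeOutput, prefixNoise, Pi.add_apply, Finset.sum_add_distrib, ← Finset.mul_sum,
    sum_dyadicIncrement (F - F') hT t j, Pi.sub_apply, h0, sub_self, sub_zero]
  field_simp
  ring

variable [Fintype ι]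

theorem map_treeOutput_le (hb : 0 < b) (hT : T < 2 ^ n) {F F' : ℕ → ι → ℝ} (h0 : F 0 = F' 0)
    {B : ι → ℝ}
    (hB : ∀ j N, ∑ i ∈ Finset.range N, |(F - F') (i + 1) j - (F - F') i j| ≤ B j) {ε : ℝ}
    (hε : n * ∑ j, B j ≤ b * ε) {E : Set (Fin T → ι → ℝ)} (hE : MeasurableSet E) :
    (treeNoise n T ι).map (treeOutput n b F) E ≤
      ENNReal.ofReal (Real.exp ε) * (treeNoise n T ι).map (treeOutput n b F') E := by
  set shift : DyadicIndex n T ι → ℝ := fun k => b⁻¹ * dyadicIncrement n T (F - F') k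
  have hshift : ∑ k, |shift k| ≤ ε := by
    simp only [shift, abs_mul, abs_of_pos (inv_pos.2 hb), ← Finset.mul_sum]
    rw [inv_mul_le_iff₀ hb]
    exact (sum_abs_dyadicIncrement_le hB).trans hε
  have hF : MeasurableSet (treeOutput n b F ⁻¹' E) := hE.preimage (by fun_prop)
  have hF' : MeasurableSet (treeOutput n b F' ⁻¹' E) := hE.preimage (by fun_prop)
  rw [Measure.map_apply (by fun_prop) hE, Measure.map_apply (by fun_prop) hE, treeNoise,
    Measure.prod_apply_symm hF, Measure.prod_apply_symm hF',
    ← lintegral_const_mul _ (measurable_measure_prodMk_right hF')]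
  refine lintegral_mono fun u => ?_
  have hpreimage : (fun z => (z, u)) ⁻¹' (treeOutput n b F ⁻¹' E) =
      (fun z => z + shift) ⁻¹' ((fun z => (z, u)) ⁻¹' (treeOutput n b F' ⁻¹' E)) := by
    ext z
    simp only [Set.mem_preimage, treeOutput_eq_add_dyadicIncrement hb.ne' hT h0 z u, shift]
  rw [hpreimage]
  refine (laplaceNoise_preimage_add_le shift (measurable_prodMk_right hF')).trans ?_
  gcongr

end Output

variable {V : Type u} [DecidableEq V] {T : ℕ} {ι : Type}

/-- The graph after `t + 1` updates (the final graph if there are not so many). -/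
def GraphSeq.graphAt (S : GraphSeq V T) (t : ℕ) : WGraph V :=
  S.graph ⟨min (t + 1) T, by omega⟩

theorem GraphSeq.graphAt_val (S : GraphSeq V T) (t : Fin T) : S.graphAt t = S.graph t.succ :=
  congrArg S.graph (Fin.ext (by simp))

/-- The values of `f` on the graphs with indices `1, …, T`, preceded by the value `0` at index `0`,
where nothing has been released yet. -/
def GraphSeq.valueSeq (f : WGraph V → ι → ℝ) (S : GraphSeq V T) : ℕ → ι → ℝ
  | 0 => 0
  | t + 1 => f (S.graphAt t)

/-- The total variation over time, summed over the output coordinates, of the difference of `f` on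
two adjacent partially dynamic sequences with the property `Q` is at most `Γ`. -/
def ContinualSensitivityLE [Fintype ι] (Q : GraphSeq V T → Prop)
    (Adj : GraphSeq V T → GraphSeq V T → Prop) (f : WGraph V → ι → ℝ) (Γ : ℝ) : Prop :=
  ∀ S S' : GraphSeq V T, S.PartiallyDynamic → S'.PartiallyDynamic → Q S → Q S' → Adj S S' →
    ∃ B : ι → ℝ, (∀ j, VariationLE (fun t => f (S.graphAt t) j - f (S'.graphAt t) j) (B j)) ∧
      ∑ j, B j ≤ Γ

theorem VariationLE.sum_abs_sub_valueSeq_le {f : WGraph V → ι → ℝ} {S S' : GraphSeq V T} {j : ι}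
    {B : ℝ} (h : VariationLE (fun t => f (S.graphAt t) j - f (S'.graphAt t) j) B) (N : ℕ) :
    ∑ i ∈ Finset.range N, |(S.valueSeq f - S'.valueSeq f) (i + 1) j -
      (S.valueSeq f - S'.valueSeq f) i j| ≤ B := by
  cases N with
  | zero => simpa using (abs_nonneg _).trans (by simpa using h 0)
  | succ N =>
    rw [Finset.sum_range_succ', add_comm]
    simpa [GraphSeq.valueSeq] using h N

namespace Mechanism

variable {A : Mechanism V T ι} {P : GraphSeq V T → Prop} {f : WGraph V → ι → ℝ} {δ err err' : ℝ}

theorem Accurate.mono (h : A.Accurate P f δ err) (hle : err ≤ err') : A.Accurate P f δ err' :=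
  fun S hS t j => (h S hS t j).trans
    (measure_mono <| Set.ofPred_subset_ofPred.2 fun _ ho => ho.trans hle)

theorem accurate_of_one_le (hδ : 1 ≤ δ) : A.Accurate P f δ err := fun S _ t j => by
  rw [ENNReal.ofReal_of_nonpos (by linarith)]
  exact zero_le

end Mechanism

variable [Fintype ι]

/-- The binary tree mechanism for `f` on `n` levels with noise level `b`. -/
noncomputable def treeMechanism (n : ℕ) (b : ℝ) (f : WGraph V → ι → ℝ) : Mechanism V T ι :=
  fun S => ⟨(treeNoise n T ι).map (treeOutput n b (S.valueSeq f)),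
    Measure.isProbabilityMeasure_map (by fun_prop)⟩

variable {n : ℕ} {b : ℝ} {f : WGraph V → ι → ℝ}

theorem online_treeMechanism (P : GraphSeq V T → Prop) : (treeMechanism n b f).Online P := by
  intro S S' _ _ t hgraph
  simp only [treeMechanism, ProbabilityMeasure.coe_mk]
  rw [Measure.map_map (by fun_prop) (by fun_prop), Measure.map_map (by fun_prop) (by fun_prop)]
  congr 1
  funext w i j
  simp only [Function.comp, treeOutput, GraphSeq.valueSeq, GraphSeq.graphAt_val, hgraph i i.2]

theorem private_treeMechanism {Q : GraphSeq V T → Prop}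
    {Adj : GraphSeq V T → GraphSeq V T → Prop} {Γ ε : ℝ} (h : ContinualSensitivityLE Q Adj f Γ)
    (hb : 0 < b) (hT : T < 2 ^ n) (hε : n * Γ ≤ b * ε) :
    (treeMechanism n b f).Private (fun S => S.PartiallyDynamic ∧ Q S) Adj ε := by
  intro S S' hS hS' hadj E hE
  obtain ⟨B, hB, hBΓ⟩ := h S S' hS.1 hS'.1 hS.2 hS'.2 hadj
  have hBε : n * ∑ j, B j ≤ b * ε := le_trans (by gcongr) hε
  exact map_treeOutput_le (F := S.valueSeq f) (F' := S'.valueSeq f) hb hT rfl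
    (fun j => (hB j).sum_abs_sub_valueSeq_le) hBε hE

theorem accurate_treeMechanism (P : GraphSeq V T → Prop) (hn : 0 < n) (hb : 0 ≤ b) {δ : ℝ}
    (hδ : 0 < δ) (hδ1 : δ ≤ 1) :
    (treeMechanism n b f).Accurate P f δ (b * (33 * √(2 * n) * Real.log (1 / δ))) := by
  intro S _ t j
  refine (le_treeNoise_abs_prefixNoise_le_log hn t j hδ hδ1).trans ?_
  rw [treeMechanism, ProbabilityMeasure.coe_mk,
    Measure.map_apply (by fun_prop) (measurableSet_le (by fun_prop) (by fun_prop))]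
  refine measure_mono fun w (hw : |prefixNoise t j w| ≤ _) => ?_
  simp only [Set.mem_preimage, Set.mem_ofPred_eq, treeOutput, GraphSeq.valueSeq,
    GraphSeq.graphAt_val, add_sub_cancel_left, abs_mul, abs_of_nonneg hb]
  gcongr

theorem natLog_two_add_one_le (hT : 2 ≤ T) : ((Nat.log 2 T + 1 : ℕ) : ℝ) ≤ 3 * Real.log T := by
  have hone : (1 : ℝ) ≤ Nat.log 2 T := by exact_mod_cast Nat.log_pos one_lt_two hT
  have hlog : Nat.log 2 T * Real.log 2 ≤ Real.log T := by
    rw [← Real.log_pow]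
    exact Real.log_le_log (by positivity) (by exact_mod_cast Nat.pow_log_le_self 2 (by omega))
  push_cast
  nlinarith [Real.log_two_gt_d9]

theorem mul_sqrt_two_mul_le_rpow {m x : ℝ} (hm : 0 ≤ m) (h : m ≤ 3 * x) :
    m * √(2 * m) ≤ 8 * x ^ (3 / 2 : ℝ) := by
  have hx : 0 ≤ x := by linarith
  have hrpow : x ^ (3 / 2 : ℝ) = x * √x := by
    rw [show (3 / 2 : ℝ) = 1 + 1 / 2 by norm_num, Real.rpow_add_of_nonneg hx (by norm_num)
      (by norm_num), Real.rpow_one, Real.sqrt_eq_rpow]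
  have hsqrt : √(2 * m) ≤ 5 / 2 * √x := by
    rw [Real.sqrt_le_left (by positivity), mul_pow, Real.sq_sqrt hx]
    linarith
  rw [hrpow]
  calc m * √(2 * m) ≤ 3 * x * (5 / 2 * √x) := by gcongr
    _ ≤ 8 * (x * √x) := by nlinarith [mul_nonneg hx (Real.sqrt_nonneg x)]

theorem mul_sqrt_mul_log_le_baseError (hT : 2 ≤ T) {ε δ Γ : ℝ} (hε : 0 < ε) (hδ : 0 < δ)
    (hδ1 : δ ≤ 1) (hΓ : 0 ≤ Γ) (hn : n = Nat.log 2 T + 1) :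
    n * Γ / ε * (33 * √(2 * n) * Real.log (1 / δ)) ≤ 264 * (Γ * baseError T ε δ) := by
  have hlog : 0 ≤ Real.log (1 / δ) := Real.log_nonneg ((one_le_div hδ).2 hδ1)
  have hlevels : n * √(2 * n) ≤ 8 * Real.log T ^ (3 / 2 : ℝ) :=
    mul_sqrt_two_mul_le_rpow n.cast_nonneg (hn ▸ natLog_two_add_one_le hT)
  calc n * Γ / ε * (33 * √(2 * n) * Real.log (1 / δ))
      = n * √(2 * n) * (33 * (Γ * (Real.log (1 / δ) / ε))) := by ring
    _ ≤ 8 * Real.log T ^ (3 / 2 : ℝ) * (33 * (Γ * (Real.log (1 / δ) / ε))) := by gcongr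
    _ = 264 * (Γ * baseError T ε δ) := by rw [baseError]; ring

theorem ContinualSensitivityLE.mono {Q : GraphSeq V T → Prop}
    {Adj : GraphSeq V T → GraphSeq V T → Prop} {Γ Γ' : ℝ} (h : ContinualSensitivityLE Q Adj f Γ)
    (hle : Γ ≤ Γ') : ContinualSensitivityLE Q Adj f Γ' := fun S S' hS hS' hQS hQS' hadj =>
  (h S S' hS hS' hQS hQS' hadj).imp fun _ hB => ⟨hB.1, hB.2.trans hle⟩

theorem ContinualSensitivityLE.hasPrivateAlgorithm {Q : GraphSeq V T → Prop}
    {Adj : GraphSeq V T → GraphSeq V T → Prop} {Γ ε δ : ℝ} (h : ContinualSensitivityLE Q Adj f Γ)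
    (hΓ : 0 < Γ) (hT : 2 ≤ T) (hε : 0 < ε) (hδ : 0 < δ) :
    HasPrivateAlgorithm Q Adj f ε δ (264 * (Γ * baseError T ε δ)) := by
  set n := Nat.log 2 T + 1 with hn
  have hb : 0 < n * Γ / ε := by positivity
  refine ⟨treeMechanism n (n * Γ / ε) f, online_treeMechanism _,
    private_treeMechanism h hb (Nat.lt_pow_succ_log_self one_lt_two T)
      (div_mul_cancel₀ _ hε.ne').ge, ?_⟩
  rcases le_total 1 δ with hδ1 | hδ1
  · exact Mechanism.accurate_of_one_le hδ1
  · exact (accurate_treeMechanism _ (Nat.succ_pos _) hb.le hδ hδ1).mono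
      (mul_sqrt_mul_log_le_baseError hT hε hδ hδ1 hΓ.le hn)

end TreeMechanism

/-! ### Partially dynamic families of graphs -/

namespace WGraph

variable {V : Type u} [DecidableEq V]

/-- The graph without the edges in `X`. Their weights are reset to `0`, so that graphs that only
differ in the edges in `X` become equal. -/
def eraseEdges (G : WGraph V) (X : Finset (Sym2 V)) : WGraph V where
  verts := G.verts
  edges := G.edges \ X
  weight := fun e => if e ∈ X then 0 else G.weight e

/-- The graph without the node `x` and its edges, the weights of which are reset to `0`. -/
def eraseVert (G : WGraph V) (x : V) : WGraph V where
  verts := G.verts.erase x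
  edges := {e ∈ G.edges | x ∉ e}
  weight := fun e => if x ∈ e then 0 else G.weight e

theorem eraseEdges_empty (G : WGraph V) : G.eraseEdges ∅ = G := by
  simp [eraseEdges]

theorem eraseEdges_insert (G : WGraph V) (e : Sym2 V) (X : Finset (Sym2 V)) :
    G.eraseEdges (insert e X) = (G.eraseEdges X).eraseEdges {e} := by
  ext1
  · rfl
  · ext e'
    simp only [eraseEdges, Finset.mem_sdiff, Finset.mem_insert, Finset.mem_singleton]
    tauto
  · funext e'
    simp only [eraseEdges, Finset.mem_insert, Finset.mem_singleton]
    split_ifs <;> tauto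

theorem eraseVert_eraseEdges (G : WGraph V) (x : V) {X : Finset (Sym2 V)}
    (hX : ∀ e ∈ X, x ∈ e) : (G.eraseEdges X).eraseVert x = G.eraseVert x := by
  ext1
  · rfl
  · ext e
    simp only [eraseEdges, eraseVert, Finset.mem_sdiff, Finset.mem_filter]
    have := hX e
    tauto
  · funext e
    have := hX e
    simp only [eraseEdges, eraseVert]
    split_ifs <;> tauto

/-- All nodes have degree at most `D`. -/
def MaxDegreeLE (D : ℕ) (G : WGraph V) : Prop := ∀ v ∈ G.verts, G.degree v ≤ D

/-- All edges have weight at most `W`. -/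
def MaxWeightLE (W : ℕ) (G : WGraph V) : Prop := ∀ e ∈ G.edges, G.weight e ≤ W

/-- The property `Q` of graphs is inherited by the graph without some of its edges. -/
def HereditaryEdges (Q : WGraph V → Prop) : Prop := ∀ G X, Q G → Q (G.eraseEdges X)

theorem hereditaryEdges_maxDegreeLE (D : ℕ) :
    HereditaryEdges (MaxDegreeLE D : WGraph V → Prop) := fun _ _ h v hv =>
  (Finset.card_le_card (Finset.filter_subset_filter _ Finset.sdiff_subset)).trans (h v hv)

theorem hereditaryEdges_maxWeightLE (W : ℕ) :
    HereditaryEdges (MaxWeightLE W : WGraph V → Prop) := fun G X h e he => by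
  obtain ⟨heG, heX⟩ := Finset.mem_sdiff.1 he
  simp only [eraseEdges, if_neg heX]
  exact h e heG

/-- The sequence of graphs behind a partially dynamic graph sequence, without the updates: simple
graphs that increase or decrease within one of them, with fixed edge weights. -/
structure IsDynamicFamily (G : ℕ → WGraph V) : Prop where
  monotone_or_antitone :
    (Monotone (fun t => (G t).verts) ∧ Monotone (fun t => (G t).edges)) ∨
    (Antitone (fun t => (G t).verts) ∧ Antitone (fun t => (G t).edges))
  exists_top : ∃ s, ∀ t, (G t).edges ⊆ (G s).edges
  not_isDiag : ∀ t, ∀ e ∈ (G t).edges, ¬ e.IsDiag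
  mem_verts : ∀ t, ∀ e ∈ (G t).edges, ∀ v ∈ e, v ∈ (G t).verts
  exists_weight : ∃ w : Sym2 V → ℕ, ∀ t, ∀ e ∈ (G t).edges, (G t).weight e = w e

theorem IsDynamicFamily.eraseEdges {G : ℕ → WGraph V} (hG : IsDynamicFamily G)
    (X : Finset (Sym2 V)) : IsDynamicFamily fun t => (G t).eraseEdges X where
  monotone_or_antitone := hG.monotone_or_antitone.imp
    (fun h => ⟨h.1, fun _ _ hst => Finset.sdiff_subset_sdiff (h.2 hst) le_rfl⟩)
    (fun h => ⟨h.1, fun _ _ hst => Finset.sdiff_subset_sdiff (h.2 hst) le_rfl⟩)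
  exists_top := hG.exists_top.imp fun _ h t => Finset.sdiff_subset_sdiff (h t) le_rfl
  not_isDiag t e he := hG.not_isDiag t e (Finset.mem_sdiff.1 he).1
  mem_verts t e he := hG.mem_verts t e (Finset.mem_sdiff.1 he).1
  exists_weight := hG.exists_weight.imp fun w h t e he => by
    obtain ⟨heG, heX⟩ := Finset.mem_sdiff.1 he
    simp only [WGraph.eraseEdges, if_neg heX]
    exact h t e heG

/-- Along every dynamic family with the property `Q`, the effect of a single edge on `f` has
variation at most `B`. -/
def EdgeVariationLE (Q : WGraph V → Prop) (f : WGraph V → ℝ) (B : ℝ) : Prop :=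
  ∀ G : ℕ → WGraph V, IsDynamicFamily G → (∀ t, Q (G t)) → ∀ e,
    VariationLE (fun t => f (G t) - f ((G t).eraseEdges {e})) B

/-- Along every dynamic family with the property `Q`, the effect of a single isolated node on `f`
has variation at most `B`. -/
def IsolatedVariationLE (Q : WGraph V → Prop) (f : WGraph V → ℝ) (B : ℝ) : Prop :=
  ∀ G : ℕ → WGraph V, IsDynamicFamily G → (∀ t, Q (G t)) → ∀ x, (∀ t, (G t).incident x = ∅) →
    VariationLE (fun t => f (G t) - f ((G t).eraseVert x)) B

/-- Along every dynamic family with the property `Q`, the effect of a single node on `f` has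
variation at most `B`. -/
def NodeVariationLE (Q : WGraph V → Prop) (f : WGraph V → ℝ) (B : ℝ) : Prop :=
  ∀ G : ℕ → WGraph V, IsDynamicFamily G → (∀ t, Q (G t)) → ∀ x,
    VariationLE (fun t => f (G t) - f ((G t).eraseVert x)) B

variable {Q : WGraph V → Prop} {f : WGraph V → ℝ} {A B : ℝ}

theorem EdgeVariationLE.eraseEdges (hf : EdgeVariationLE Q f B) (hQ : HereditaryEdges Q)
    {G : ℕ → WGraph V} (hG : IsDynamicFamily G) (hQG : ∀ t, Q (G t)) (X : Finset (Sym2 V)) :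
    VariationLE (fun t => f (G t) - f ((G t).eraseEdges X)) (X.card * B) := by
  induction X using Finset.induction_on with
  | empty => simpa [eraseEdges_empty] using VariationLE.zero
  | insert e X he ih =>
    have hadd := ih.add (hf _ (hG.eraseEdges X) (fun t => hQ _ X (hQG t)) e)
    simp only [sub_add_sub_cancel, ← eraseEdges_insert] at hadd
    refine hadd.mono (le_of_eq ?_)
    rw [Finset.card_insert_of_notMem he]
    push_cast
    ring

theorem EdgeVariationLE.nodeVariationLE (hf : EdgeVariationLE Q f B)
    (hf' : IsolatedVariationLE Q f A) (hQ : HereditaryEdges Q) {D : ℕ}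
    (hD : ∀ G, Q G → G.MaxDegreeLE D) (hB : 0 ≤ B) : NodeVariationLE Q f (D * B + A) := by
  intro G hG hQG x
  obtain ⟨s, hs⟩ := hG.exists_top
  set X := (G s).incident x
  have hmem_of_mem : ∀ e ∈ X, x ∈ e := fun e he => (Finset.mem_filter.1 he).2
  have hcard : X.card ≤ D := by
    rcases X.eq_empty_or_nonempty with hempty | ⟨e, he⟩
    · simp [hempty]
    · obtain ⟨he, hxe⟩ := Finset.mem_filter.1 he
      exact hD _ (hQG s) x (hG.mem_verts s e he x hxe)
  have hisolated (t : ℕ) : ((G t).eraseEdges X).incident x = ∅ := by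
    refine Finset.eq_empty_of_forall_notMem fun e he => ?_
    obtain ⟨he, hxe⟩ := Finset.mem_filter.1 he
    obtain ⟨heG, heX⟩ := Finset.mem_sdiff.1 he
    exact heX (Finset.mem_filter.2 ⟨hs t heG, hxe⟩)
  have hadd := (hf.eraseEdges hQ hG hQG X).add
    (hf' _ (hG.eraseEdges X) (fun t => hQ _ X (hQG t)) x hisolated)
  simp only [sub_add_sub_cancel, eraseVert_eraseEdges _ x hmem_of_mem] at hadd
  refine hadd.mono ?_
  gcongr

end WGraph

/-! ### Adjacent graph sequences -/

namespace GraphSeq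

variable {V : Type u} [DecidableEq V] {T : ℕ}

theorem edge_valid (S : GraphSeq V T) (i : Fin (T + 1)) :
    ∀ e ∈ S.edges i, ¬ e.IsDiag ∧ ∀ v ∈ e, v ∈ S.verts i := by
  induction i using Fin.induction with
  | zero => exact S.edges_zero
  | succ i ih =>
    intro e he
    rw [S.edges_succ, Finset.mem_union, Finset.mem_sdiff] at he
    rcases he with ⟨he, hdel⟩ | he
    · refine ⟨(ih e he).1, fun v hv => ?_⟩
      rw [S.verts_succ]
      exact Finset.mem_union_left _ (Finset.mem_sdiff.2
        ⟨(ih e he).2 v hv, fun hv_del => hdel (S.eDel_of_vDel i v hv_del e he hv)⟩)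
    · exact S.eIns_valid i e he

theorem Incremental.monotone {S : GraphSeq V T} (hS : S.Incremental) :
    Monotone S.verts ∧ Monotone S.edges := by
  constructor <;> refine Fin.monotone_iff_le_succ.2 fun i => ?_
  · rw [S.verts_succ, (hS i).2, Finset.sdiff_empty]
    exact Finset.subset_union_left
  · rw [S.edges_succ, (hS i).1, Finset.sdiff_empty]
    exact Finset.subset_union_left

theorem Decremental.antitone {S : GraphSeq V T} (hS : S.Decremental) :
    Antitone S.verts ∧ Antitone S.edges := by
  constructor <;> refine Fin.antitone_iff_succ_le.2 fun i => ?_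
  · rw [S.verts_succ, (hS i).2, Finset.union_empty]
    exact Finset.sdiff_subset
  · rw [S.edges_succ, (hS i).1, Finset.union_empty]
    exact Finset.sdiff_subset

theorem PartiallyDynamic.isDynamicFamily {S : GraphSeq V T} (hS : S.PartiallyDynamic) :
    WGraph.IsDynamicFamily S.graphAt where
  monotone_or_antitone := by
    have hindex : Monotone fun t : ℕ => (⟨min (t + 1) T, by omega⟩ : Fin (T + 1)) :=
      fun s t hst => Fin.mk_le_mk.2 (by omega)
    exact hS.imp (fun h => ⟨h.monotone.1.comp hindex, h.monotone.2.comp hindex⟩)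
      (fun h => ⟨h.antitone.1.comp_monotone hindex, h.antitone.2.comp_monotone hindex⟩)
  exists_top := by
    rcases hS with h | h
    · exact ⟨T, fun t => h.monotone.2 (Fin.mk_le_mk.2 (by omega))⟩
    · exact ⟨0, fun t => h.antitone.2 (Fin.mk_le_mk.2 (by omega))⟩
  not_isDiag t e he := (S.edge_valid _ e he).1
  mem_verts t e he := (S.edge_valid _ e he).2
  exists_weight := ⟨S.weight, fun t e he => if_pos he⟩

theorem graphAt_of_forall_succ {S : GraphSeq V T} (hT : 0 < T) {Q : WGraph V → Prop}
    (h : ∀ i : Fin T, Q (S.graph i.succ)) (t : ℕ) : Q (S.graphAt t) := by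
  have hindex : (⟨min (t + 1) T, by omega⟩ : Fin (T + 1)) =
      (⟨min t (T - 1), by omega⟩ : Fin T).succ := Fin.ext (by simp; omega)
  rw [graphAt, hindex]
  exact h _

theorem mem_iff_of_updates {α : Type*} [DecidableEq α] {X X' : Fin (T + 1) → Finset α}
    {D D' I I' : Fin T → Finset α} (hX : ∀ t, X t.succ = (X t.castSucc \ D t) ∪ I t)
    (hX' : ∀ t, X' t.succ = (X' t.castSucc \ D' t) ∪ I' t) {y : α} (h0 : y ∈ X 0 ↔ y ∈ X' 0)
    (hD : ∀ t, y ∈ D t ↔ y ∈ D' t) (hI : ∀ t, y ∈ I t ↔ y ∈ I' t) (i : Fin (T + 1)) :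
    y ∈ X i ↔ y ∈ X' i := by
  induction i using Fin.induction with
  | zero => exact h0
  | succ t ih => simp only [hX, hX', Finset.mem_union, Finset.mem_sdiff, ih, hD, hI]

theorem DropsOnce.mem_iff {α : Type u} [DecidableEq α] {x y : α} {A A' : Fin T → Finset α}
    (h : DropsOnce x A A') (hy : y ≠ x) (t : Fin T) : y ∈ A t ↔ y ∈ A' t := by
  obtain ⟨hsub, s, hs, hne⟩ := h
  rcases eq_or_ne t s with rfl | hts
  · refine ⟨fun hyA => by_contra fun hyA' => hy ?_, fun hyA => hsub t hyA⟩
    exact Finset.mem_singleton.1 (hs ▸ Finset.mem_sdiff.2 ⟨hyA, hyA'⟩)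
  · rw [hne t hts]

theorem DropsOnce.mem_iff_and_mem_iff {α : Type u} [DecidableEq α] {x y : α}
    {D D' I I' : Fin T → Finset α}
    (h : (D = D' ∧ DropsOnce x I I') ∨ (I = I' ∧ DropsOnce x D D')) (hy : y ≠ x) :
    (∀ t, y ∈ D t ↔ y ∈ D' t) ∧ (∀ t, y ∈ I t ↔ y ∈ I' t) := by
  rcases h with ⟨rfl, h⟩ | ⟨rfl, h⟩
  · exact ⟨fun _ => Iff.rfl, h.mem_iff hy⟩
  · exact ⟨h.mem_iff hy, fun _ => Iff.rfl⟩

theorem EdgeAdjOn.eraseEdges_eq {x : Sym2 V} {S S' : GraphSeq V T} (h : EdgeAdjOn x S S')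
    (i : Fin (T + 1)) : (S.graph i).eraseEdges {x} = (S'.graph i).eraseEdges {x} := by
  obtain ⟨h0, hw, hvd, hvi, hadj⟩ := h
  have hverts (v : V) : v ∈ S.verts i ↔ v ∈ S'.verts i :=
    mem_iff_of_updates S.verts_succ S'.verts_succ (Finset.ext_iff.1 (congrArg WGraph.verts h0) v)
      (fun t => by rw [hvd]) (fun t => by rw [hvi]) i
  have hedges (e : Sym2 V) (he : e ≠ x) : e ∈ S.edges i ↔ e ∈ S'.edges i :=
    have ⟨hdel, hins⟩ := DropsOnce.mem_iff_and_mem_iff hadj he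
    mem_iff_of_updates S.edges_succ S'.edges_succ
      (Finset.ext_iff.1 (congrArg WGraph.edges h0) e) hdel hins i
  ext1
  · exact Finset.ext hverts
  · ext e
    simp only [WGraph.eraseEdges, graph, Finset.mem_sdiff, Finset.mem_singleton]
    have := hedges e
    tauto
  · funext e
    simp only [WGraph.eraseEdges, graph, Finset.mem_singleton]
    by_cases he : e = x
    · rw [if_pos he, if_pos he]
    · simp only [hedges e he, hw e he]

theorem NodeAdjOn.eraseVert_eq {x : V} {S S' : GraphSeq V T} (h : NodeAdjOn x S S')
    (i : Fin (T + 1)) : (S.graph i).eraseVert x = (S'.graph i).eraseVert x := by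
  obtain ⟨h0, hw, hadj, -, -, hins, hdel⟩ := h
  have hverts (v : V) (hv : v ≠ x) : v ∈ S.verts i ↔ v ∈ S'.verts i :=
    have ⟨hvd, hvi⟩ := DropsOnce.mem_iff_and_mem_iff hadj hv
    mem_iff_of_updates S.verts_succ S'.verts_succ
      (Finset.ext_iff.1 (congrArg WGraph.verts h0) v) hvd hvi i
  have hedges (e : Sym2 V) (he : x ∉ e) : e ∈ S.edges i ↔ e ∈ S'.edges i :=
    mem_iff_of_updates S.edges_succ S'.edges_succ (Finset.ext_iff.1 (congrArg WGraph.edges h0) e)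
      (fun t => hdel t e he) (fun t => hins t e he) i
  ext1
  · ext v
    simp only [WGraph.eraseVert, graph, Finset.mem_erase]
    have := hverts v
    tauto
  · ext e
    simp only [WGraph.eraseVert, graph, Finset.mem_filter]
    have := hedges e
    tauto
  · funext e
    simp only [WGraph.eraseVert, graph]
    by_cases he : x ∈ e
    · rw [if_pos he, if_pos he]
    · simp only [hedges e he, hw e he]

end GraphSeq

namespace WGraph

variable {V : Type u} [DecidableEq V] {T : ℕ} {ι : Type} [Fintype ι] {P : GraphSeq V T → Prop}
  {Q : WGraph V → Prop} {f : WGraph V → ι → ℝ} {B : ℝ}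

theorem EdgeVariationLE.continualSensitivityLE (hf : ∀ j, EdgeVariationLE Q (f · j) B)
    (hT : 0 < T) (hP : ∀ S, P S → ∀ i : Fin T, Q (S.graph i.succ)) :
    ContinualSensitivityLE P GraphSeq.EdgeAdj f (Fintype.card ι * (B + B)) := by
  rintro S S' hS hS' hPS hPS' ⟨x, hx⟩
  refine ⟨fun _ => B + B, fun j => ?_, by simp [mul_add]⟩
  have heq (t : ℕ) : (S.graphAt t).eraseEdges {x} = (S'.graphAt t).eraseEdges {x} :=
    hx.elim (fun h => h.eraseEdges_eq _) (fun h => (h.eraseEdges_eq _).symm)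
  have hsub := (hf j _ hS.isDynamicFamily (S.graphAt_of_forall_succ hT (hP S hPS)) x).sub
    (hf j _ hS'.isDynamicFamily (S'.graphAt_of_forall_succ hT (hP S' hPS')) x)
  simpa only [heq, sub_sub_sub_cancel_right] using hsub

theorem NodeVariationLE.continualSensitivityLE (hf : ∀ j, NodeVariationLE Q (f · j) B)
    (hT : 0 < T) (hP : ∀ S, P S → ∀ i : Fin T, Q (S.graph i.succ)) :
    ContinualSensitivityLE P GraphSeq.NodeAdj f (Fintype.card ι * (B + B)) := by
  rintro S S' hS hS' hPS hPS' ⟨x, hx⟩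
  refine ⟨fun _ => B + B, fun j => ?_, by simp [mul_add]⟩
  have heq (t : ℕ) : (S.graphAt t).eraseVert x = (S'.graphAt t).eraseVert x :=
    hx.elim (fun h => h.eraseVert_eq _) (fun h => (h.eraseVert_eq _).symm)
  have hsub := (hf j _ hS.isDynamicFamily (S.graphAt_of_forall_succ hT (hP S hPS)) x).sub
    (hf j _ hS'.isDynamicFamily (S'.graphAt_of_forall_succ hT (hP S' hPS')) x)
  simpa only [heq, sub_sub_sub_cancel_right] using hsub

end WGraph

/-! ### Counting functions -/

theorem VariationLE.sum_toFinset {V : Type u} [DecidableEq V] {F : V → ℕ → ℝ} {B : ℝ}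
    (e : Sym2 V) (h : ∀ v ∈ e, VariationLE (F v) B) (hB : 0 ≤ B) :
    VariationLE (fun t => ∑ v ∈ e.toFinset, F v t) (2 * B) := by
  refine (VariationLE.sum e.toFinset (C := fun _ => B)
    fun v hv => h v (Sym2.mem_toFinset.1 hv)).mono ?_
  have hcard : e.toFinset.card ≤ 2 := by
    rw [Sym2.card_toFinset]
    split_ifs <;> simp
  rw [Finset.sum_const, nsmul_eq_mul]
  gcongr
  exact_mod_cast hcard

namespace WGraph

variable {V : Type u}

theorem IsDynamicFamily.monotone_or_antitone_comp {G : ℕ → WGraph V} (hG : IsDynamicFamily G)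
    {α : Type*} [Preorder α] {φ : WGraph V → α}
    (hφ : ∀ G H : WGraph V, G.verts ⊆ H.verts → G.edges ⊆ H.edges → φ G ≤ φ H) :
    Monotone (fun t => φ (G t)) ∨ Antitone (fun t => φ (G t)) :=
  hG.monotone_or_antitone.imp (fun h _ _ hst => hφ _ _ (h.1 hst) (h.2 hst))
    (fun h _ _ hst => hφ _ _ (h.1 hst) (h.2 hst))

variable [DecidableEq V] {Q : WGraph V → Prop}

theorem degree_mono {G H : WGraph V} (h : G.edges ⊆ H.edges) (v : V) : G.degree v ≤ H.degree v :=
  Finset.card_le_card (Finset.filter_subset_filter _ h)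

theorem eraseEdges_edges_subset {G H : WGraph V} (h : G.edges ⊆ H.edges) (X : Finset (Sym2 V)) :
    (G.eraseEdges X).edges ⊆ (H.eraseEdges X).edges :=
  Finset.sdiff_subset_sdiff h le_rfl

theorem eraseEdges_singleton_edges_of_notMem (G : WGraph V) {e : Sym2 V} (he : e ∉ G.edges) :
    (G.eraseEdges {e}).edges = G.edges :=
  Finset.sdiff_eq_self_of_disjoint (Finset.disjoint_singleton_right.2 he)

theorem eraseVert_edges_of_incident_eq_empty {G : WGraph V} {x : V} (h : G.incident x = ∅) :
    (G.eraseVert x).edges = G.edges :=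
  Finset.filter_true_of_mem (Finset.filter_eq_empty_iff.1 h)

theorem incident_eraseEdges_singleton (G : WGraph V) (e : Sym2 V) (v : V) :
    (G.eraseEdges {e}).incident v = (G.incident v).erase e := by
  ext e'
  simp only [incident, eraseEdges, Finset.mem_filter, Finset.mem_sdiff, Finset.mem_singleton,
    Finset.mem_erase]
  tauto

theorem degree_eraseEdges_of_notMem_incident (G : WGraph V) {e : Sym2 V} {v : V}
    (h : e ∉ G.incident v) : (G.eraseEdges {e}).degree v = G.degree v := by
  rw [degree, incident_eraseEdges_singleton, Finset.erase_eq_of_notMem h, degree]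

theorem degree_eraseEdges_add_one (G : WGraph V) {e : Sym2 V} {v : V} (h : e ∈ G.incident v) :
    (G.eraseEdges {e}).degree v + 1 = G.degree v := by
  rw [degree, incident_eraseEdges_singleton, Finset.card_erase_add_one h, degree]

theorem edgeCount_sub_eraseEdges (G : WGraph V) (e : Sym2 V) :
    (G.edgeCount : ℝ) - (G.eraseEdges {e}).edgeCount = if e ∈ G.edges then 1 else 0 := by
  split_ifs with he
  · have herase : (G.eraseEdges {e}).edges = G.edges.erase e := Finset.sdiff_singleton_eq_erase _ _
    rw [edgeCount, edgeCount, herase, ← Finset.card_erase_add_one he]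
    push_cast
    ring
  · rw [edgeCount, edgeCount, eraseEdges_singleton_edges_of_notMem _ he, sub_self]

theorem edgeVariationLE_edgeCount :
    EdgeVariationLE Q (fun G : WGraph V => (G.edgeCount : ℝ)) 2 := by
  intro G hG _ e
  simp only [edgeCount_sub_eraseEdges]
  exact VariationLE.indicator
    (hG.monotone_or_antitone_comp (φ := fun G => e ∈ G.edges) fun _ _ _ h he => h he)

theorem isolatedVariationLE_edgeCount :
    IsolatedVariationLE Q (fun G : WGraph V => (G.edgeCount : ℝ)) 0 := by
  intro G _ _ x hx
  simpa [edgeCount, eraseVert_edges_of_incident_eq_empty (hx _)] using VariationLE.zero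

/-- The sum of `φ (deg v)` over all nodes `v`, of which the numbers of nodes of large degree and
of `k`-stars are special cases. -/
def degreeSum (φ : ℕ → ℝ) (G : WGraph V) : ℝ := ∑ v ∈ G.verts, φ (G.degree v)

theorem degreeSum_sub_eraseEdges (φ : ℕ → ℝ) (G : WGraph V) (e : Sym2 V) :
    G.degreeSum φ - (G.eraseEdges {e}).degreeSum φ = ∑ v ∈ e.toFinset,
      if v ∈ G.verts then φ (G.degree v) - φ ((G.eraseEdges {e}).degree v) else 0 := by
  have hverts : (G.eraseEdges {e}).verts = G.verts := rfl
  rw [degreeSum, degreeSum, hverts, ← Finset.sum_sub_distrib, Finset.sum_ite_mem,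
    Finset.inter_comm]
  refine (Finset.sum_subset Finset.inter_subset_left fun v hv hv' => ?_).symm
  have hve : v ∉ e := fun h => hv' (Finset.mem_inter.2 ⟨hv, Sym2.mem_toFinset.2 h⟩)
  rw [degree_eraseEdges_of_notMem_incident G fun h => hve (Finset.mem_filter.1 h).2, sub_self]

theorem degreeSum_sub_eraseVert (φ : ℕ → ℝ) (G : WGraph V) {x : V} (hx : G.incident x = ∅) :
    G.degreeSum φ - (G.eraseVert x).degreeSum φ = if x ∈ G.verts then φ 0 else 0 := by
  have hdegree (v : V) : (G.eraseVert x).degree v = G.degree v := by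
    rw [degree, degree, incident, incident, eraseVert_edges_of_incident_eq_empty hx]
  have hverts : (G.eraseVert x).verts = G.verts.erase x := rfl
  simp only [degreeSum, hdegree, hverts]
  split_ifs with h
  · rw [← Finset.add_sum_erase _ _ h, add_sub_cancel_right, degree, hx, Finset.card_empty]
  · rw [Finset.erase_eq_of_notMem h, sub_self]

theorem isolatedVariationLE_degreeSum {φ : ℕ → ℝ} (hφ₀ : 0 ≤ φ 0) (hφ₁ : φ 0 ≤ 1) :
    IsolatedVariationLE Q (degreeSum φ : WGraph V → ℝ) 2 := by
  intro G hG _ x hx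
  simp only [degreeSum_sub_eraseVert φ _ (hx _)]
  rw [← mul_one (2 : ℝ)]
  refine VariationLE.of_monotone_or_antitone
    (hG.monotone_or_antitone_comp (φ := fun G => if x ∈ G.verts then φ 0 else 0)
      fun G H hverts _ => ?_)
    (fun t => by split_ifs <;> simp [hφ₀]) (fun t => by split_ifs <;> simp [hφ₁])
  split_ifs with hxG hxH
  exacts [le_rfl, absurd (hverts hxG) hxH, hφ₀, le_rfl]

theorem highDegreeCount_eq_degreeSum (τ : ℕ) (G : WGraph V) :
    (G.highDegreeCount τ : ℝ) = G.degreeSum fun d => if τ ≤ d then 1 else 0 := by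
  simp [highDegreeCount, degreeSum, Finset.sum_boole]

theorem edgeVariationLE_highDegreeCount (τ : ℕ) :
    EdgeVariationLE Q (fun G : WGraph V => (G.highDegreeCount τ : ℝ)) 8 := by
  intro G hG _ e
  simp only [highDegreeCount_eq_degreeSum, degreeSum_sub_eraseEdges]
  refine (VariationLE.sum_toFinset (B := 2 + 2) e (fun v _ => ?_) (by norm_num)).mono
    (by norm_num)
  have hwith := VariationLE.indicator (hG.monotone_or_antitone_comp
    (φ := fun G => v ∈ G.verts ∧ τ ≤ G.degree v)
    fun G H hverts hedges h => ⟨hverts h.1, h.2.trans (degree_mono hedges v)⟩)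
  have hwithout := VariationLE.indicator (hG.monotone_or_antitone_comp
    (φ := fun G => v ∈ G.verts ∧ τ ≤ (G.eraseEdges {e}).degree v)
    fun G H hverts hedges h =>
      ⟨hverts h.1, h.2.trans (degree_mono (eraseEdges_edges_subset hedges _) v)⟩)
  convert! hwith.sub hwithout using 2 with t
  by_cases hv : v ∈ (G t).verts <;> simp [hv]

theorem isolatedVariationLE_highDegreeCount (τ : ℕ) :
    IsolatedVariationLE Q (fun G : WGraph V => (G.highDegreeCount τ : ℝ)) 2 := by
  simp only [highDegreeCount_eq_degreeSum]
  exact isolatedVariationLE_degreeSum (by split_ifs <;> simp) (by split_ifs <;> simp)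

theorem degreeBin_eq_sub (j : ℕ) (G : WGraph V) :
    (G.degreeBin j : ℝ) = G.highDegreeCount j - G.highDegreeCount (j + 1) := by
  rw [highDegreeCount_eq_degreeSum, highDegreeCount_eq_degreeSum, degreeSum, degreeSum,
    ← Finset.sum_sub_distrib, degreeBin, Finset.card_filter]
  push_cast
  refine Finset.sum_congr rfl fun v _ => ?_
  split_ifs <;> first | omega | simp

theorem edgeVariationLE_degreeBin (j : ℕ) :
    EdgeVariationLE Q (fun G : WGraph V => (G.degreeBin j : ℝ)) 16 := by
  intro G hG hQ e
  simp only [degreeBin_eq_sub, sub_sub_sub_comm _ _ ((highDegreeCount j _ : ℕ) : ℝ)]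
  exact ((edgeVariationLE_highDegreeCount j G hG hQ e).sub
    (edgeVariationLE_highDegreeCount (j + 1) G hG hQ e)).mono (by norm_num)

theorem isolatedVariationLE_degreeBin (j : ℕ) :
    IsolatedVariationLE Q (fun G : WGraph V => (G.degreeBin j : ℝ)) 4 := by
  intro G hG hQ x hx
  simp only [degreeBin_eq_sub, sub_sub_sub_comm _ _ ((highDegreeCount j _ : ℕ) : ℝ)]
  exact ((isolatedVariationLE_highDegreeCount j G hG hQ x hx).sub
    (isolatedVariationLE_highDegreeCount (j + 1) G hG hQ x hx)).mono (by norm_num)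

theorem kStarCount_eq_degreeSum (k : ℕ) (G : WGraph V) :
    (G.kStarCount k : ℝ) = G.degreeSum fun d => (d.choose k : ℝ) := by
  simp [kStarCount, degreeSum, degree]

theorem edgeVariationLE_kStarCount_zero :
    EdgeVariationLE Q (fun G : WGraph V => (G.kStarCount 0 : ℝ)) 0 := by
  intro G _ _ e
  simpa [kStarCount_eq_degreeSum, degreeSum_sub_eraseEdges] using VariationLE.zero

theorem choose_degree_sub_eraseEdges (G : WGraph V) {e : Sym2 V} {v : V} (hv : v ∈ e) (k : ℕ) :
    ((G.degree v).choose (k + 1) : ℝ) - ((G.eraseEdges {e}).degree v).choose (k + 1) =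
      if e ∈ G.edges then (((G.eraseEdges {e}).degree v).choose k : ℝ) else 0 := by
  split_ifs with he
  · rw [← degree_eraseEdges_add_one G (Finset.mem_filter.2 ⟨he, hv⟩), Nat.choose_succ_succ]
    push_cast
    ring
  · rw [degree_eraseEdges_of_notMem_incident G fun h => he (Finset.mem_filter.1 h).1, sub_self]

theorem edgeVariationLE_kStarCount_succ (D k : ℕ) :
    EdgeVariationLE (MaxDegreeLE D) (fun G : WGraph V => (G.kStarCount (k + 1) : ℝ))
      (4 * D ^ k) := by
  intro G hG hD e
  simp only [kStarCount_eq_degreeSum, degreeSum_sub_eraseEdges]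
  refine (VariationLE.sum_toFinset (B := 2 * D ^ k) e (fun v hv => ?_) (by positivity)).mono
    (by linarith)
  simp only [choose_degree_sub_eraseEdges _ hv, ← ite_and]
  refine VariationLE.of_monotone_or_antitone (hG.monotone_or_antitone_comp (φ := fun G =>
    if v ∈ G.verts ∧ e ∈ G.edges then (((G.eraseEdges {e}).degree v).choose k : ℝ) else 0)
    fun G H hverts hedges => ?_) (fun t => by positivity) (fun t => ?_)
  · split_ifs with hveG hveH
    · exact_mod_cast Nat.choose_le_choose k (degree_mono (eraseEdges_edges_subset hedges _) v)
    · exact absurd ⟨hverts hveG.1, hedges hveG.2⟩ hveH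
    · positivity
    · exact le_rfl
  · split_ifs with hve
    · have hdegree : ((G t).eraseEdges {e}).degree v ≤ D :=
        hereditaryEdges_maxDegreeLE D _ _ (hD t) v hve.1
      exact_mod_cast (Nat.choose_le_pow _ k).trans (Nat.pow_le_pow_left hdegree k)
    · positivity

theorem isolatedVariationLE_kStarCount (k : ℕ) :
    IsolatedVariationLE Q (fun G : WGraph V => (G.kStarCount k : ℝ)) 2 := by
  simp only [kStarCount_eq_degreeSum]
  exact isolatedVariationLE_degreeSum (by positivity) (by cases k <;> simp)

theorem edgeVariationLE_kStarCount {D : ℕ} (hD : 1 ≤ D) (k : ℕ) :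
    EdgeVariationLE (MaxDegreeLE D) (fun G : WGraph V => (G.kStarCount k : ℝ)) (4 * D ^ k) := by
  intro G hG hQ e
  cases k with
  | zero => exact (edgeVariationLE_kStarCount_zero G hG hQ e).mono (by positivity)
  | succ k =>
    refine (edgeVariationLE_kStarCount_succ D k G hG hQ e).mono ?_
    gcongr
    exacts [by exact_mod_cast hD, k.le_succ]

theorem nodeVariationLE_kStarCount {D : ℕ} (hD : 1 ≤ D) (k : ℕ) :
    NodeVariationLE (MaxDegreeLE D) (fun G : WGraph V => (G.kStarCount k : ℝ)) (6 * D ^ k) := by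
  intro G hG hQ x
  cases k with
  | zero =>
    refine (edgeVariationLE_kStarCount_zero.nodeVariationLE (isolatedVariationLE_kStarCount 0)
      (hereditaryEdges_maxDegreeLE D) (fun _ h => h) le_rfl G hG hQ x).mono ?_
    norm_num
  | succ k =>
    refine ((edgeVariationLE_kStarCount_succ D k).nodeVariationLE
      (isolatedVariationLE_kStarCount (k + 1)) (hereditaryEdges_maxDegreeLE D) (fun _ h => h)
      (by positivity) G hG hQ x).mono ?_
    have hpow : (1 : ℝ) ≤ D ^ (k + 1) := one_le_pow₀ (by exact_mod_cast hD)
    linarith [show (D : ℝ) * (4 * D ^ k) = 4 * D ^ (k + 1) by ring]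

/-- The vertex sets of the triangles of `G`, the number of which is `G.triangleCount`. -/
def triangles (G : WGraph V) : Finset (Finset V) :=
  {s ∈ G.verts.powersetCard 3 | ∀ a ∈ s, ∀ b ∈ s, a ≠ b → s(a, b) ∈ G.edges}

theorem card_triangles (G : WGraph V) : G.triangles.card = G.triangleCount := rfl

theorem mem_triangles {G : WGraph V} {s : Finset V} : s ∈ G.triangles ↔
    (s ⊆ G.verts ∧ s.card = 3) ∧ ∀ a ∈ s, ∀ b ∈ s, a ≠ b → s(a, b) ∈ G.edges := by
  rw [triangles, Finset.mem_filter, Finset.mem_powersetCard]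

theorem triangles_mono {G H : WGraph V} (hverts : G.verts ⊆ H.verts)
    (hedges : G.edges ⊆ H.edges) : G.triangles ⊆ H.triangles := fun s hs => by
  rw [mem_triangles] at hs ⊢
  exact ⟨⟨hs.1.1.trans hverts, hs.1.2⟩, fun a ha b hb hab => hedges (hs.2 a ha b hb hab)⟩

theorem triangles_eraseEdges (G : WGraph V) {u v : V} (huv : u ≠ v) :
    (G.eraseEdges {s(u, v)}).triangles = {s ∈ G.triangles | ¬ (u ∈ s ∧ v ∈ s)} := by
  ext s
  rw [Finset.mem_filter, mem_triangles, mem_triangles]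
  simp only [eraseEdges, Finset.mem_sdiff, Finset.mem_singleton]
  constructor
  · rintro ⟨hs, hadj⟩
    exact ⟨⟨hs, fun a ha b hb hab => (hadj a ha b hb hab).1⟩,
      fun h => (hadj u h.1 v h.2 huv).2 rfl⟩
  · rintro ⟨⟨hs, hadj⟩, huvs⟩
    refine ⟨hs, fun a ha b hb hab => ⟨hadj a ha b hb hab, fun h => huvs ?_⟩⟩
    rcases Sym2.eq_iff.1 h with ⟨rfl, rfl⟩ | ⟨rfl, rfl⟩
    exacts [⟨ha, hb⟩, ⟨hb, ha⟩]

theorem triangles_eraseVert (G : WGraph V) {x : V} (hx : G.incident x = ∅) :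
    (G.eraseVert x).triangles = G.triangles := by
  ext s
  rw [mem_triangles, mem_triangles, eraseVert_edges_of_incident_eq_empty hx]
  refine ⟨fun h => ⟨⟨h.1.1.trans (Finset.erase_subset _ _), h.1.2⟩, h.2⟩,
    fun h => ⟨⟨Finset.subset_erase.2 ⟨h.1.1, fun hxs => ?_⟩, h.1.2⟩, h.2⟩⟩
  obtain ⟨y, hy, hyx⟩ := Finset.exists_mem_ne (by omega : 1 < s.card) x
  exact Finset.filter_eq_empty_iff.1 hx (h.2 x hxs y hy hyx.symm) (Sym2.mem_mk_left _ _)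

/-- The triangles of `G` that contain both `u` and `v`: if `u ≠ v`, these are the ones that
disappear with the edge `s(u, v)`. -/
def trianglesAt (G : WGraph V) (u v : V) : Finset (Finset V) :=
  {s ∈ G.triangles | u ∈ s ∧ v ∈ s}

theorem triangleCount_sub_eraseEdges (G : WGraph V) {u v : V} (huv : u ≠ v) :
    (G.triangleCount : ℝ) - (G.eraseEdges {s(u, v)}).triangleCount =
      (G.trianglesAt u v).card := by
  rw [← card_triangles, ← card_triangles, triangles_eraseEdges G huv, trianglesAt,
    ← Finset.card_filter_add_card_filter_not (fun s => u ∈ s ∧ v ∈ s) (s := G.triangles)]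
  push_cast
  ring

theorem card_trianglesAt_le (G : WGraph V) {u v : V} (huv : u ≠ v) :
    (G.trianglesAt u v).card ≤ G.degree u := by
  refine (Finset.card_le_card (t := (G.incident u).image fun e => insert v e.toFinset)
    fun s hs => ?_).trans Finset.card_image_le
  rw [trianglesAt, Finset.mem_filter, mem_triangles] at hs
  obtain ⟨⟨⟨-, hcard⟩, hadj⟩, hu, hv⟩ := hs
  have hvs : v ∈ s.erase u := Finset.mem_erase.2 ⟨huv.symm, hv⟩
  obtain ⟨w, hw⟩ : ∃ w, (s.erase u).erase v = {w} := by
    rw [← Finset.card_eq_one, Finset.card_erase_of_mem hvs, Finset.card_erase_of_mem hu, hcard]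
  have hws : w ∈ (s.erase u).erase v := hw ▸ Finset.mem_singleton_self w
  obtain ⟨-, hwu, hws⟩ : w ≠ v ∧ w ≠ u ∧ w ∈ s := by simpa only [Finset.mem_erase] using hws
  refine Finset.mem_image.2 ⟨s(u, w), Finset.mem_filter.2
    ⟨hadj u hu w hws hwu.symm, Sym2.mem_mk_left _ _⟩, ?_⟩
  calc insert v s(u, w).toFinset = insert u (insert v {w}) := by
        rw [Sym2.toFinset_mk_eq, Finset.insert_comm]
    _ = s := by rw [← hw, Finset.insert_erase hvs, Finset.insert_erase hu]

theorem card_trianglesAt_le_of_maxDegreeLE {G : WGraph V} {D : ℕ} (hG : G.MaxDegreeLE D)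
    {u v : V} (huv : u ≠ v) : (G.trianglesAt u v).card ≤ D := by
  rcases (G.trianglesAt u v).eq_empty_or_nonempty with hempty | ⟨s, hs⟩
  · simp [hempty]
  · obtain ⟨hs, hus, -⟩ := Finset.mem_filter.1 hs
    exact (card_trianglesAt_le G huv).trans (hG u ((mem_triangles.1 hs).1.1 hus))

theorem edgeVariationLE_triangleCount (D : ℕ) :
    EdgeVariationLE (MaxDegreeLE D) (fun G : WGraph V => (G.triangleCount : ℝ)) (2 * D) := by
  intro G hG hD e
  induction e using Sym2.ind with
  | _ u v =>
    rcases eq_or_ne u v with rfl | huv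
    · have heq (t : ℕ) : ((G t).eraseEdges {s(u, u)}).triangleCount = (G t).triangleCount := by
        have hloop : s(u, u) ∉ (G t).edges := fun h => hG.not_isDiag t _ h (by simp)
        rw [triangleCount, triangleCount, eraseEdges_singleton_edges_of_notMem _ hloop]
        rfl
      simp only [heq, sub_self]
      exact VariationLE.zero.mono (by positivity)
    · simp only [triangleCount_sub_eraseEdges _ huv]
      refine VariationLE.of_monotone_or_antitone (hG.monotone_or_antitone_comp
        (φ := fun G => ((G.trianglesAt u v).card : ℝ)) fun G H hverts hedges => ?_)
        (fun t => by positivity)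
        (fun t => by exact_mod_cast card_trianglesAt_le_of_maxDegreeLE (hD t) huv)
      exact_mod_cast Finset.card_le_card
        (Finset.filter_subset_filter _ (triangles_mono hverts hedges))

theorem isolatedVariationLE_triangleCount :
    IsolatedVariationLE Q (fun G : WGraph V => (G.triangleCount : ℝ)) 0 := by
  intro G _ _ x hx
  simpa [← card_triangles, triangles_eraseVert _ (hx _)] using VariationLE.zero

end WGraph

/-! ### The graphic rank -/

theorem exists_linearIndepOn_forall_mem_span_sublevel (K : Type*) {M α β : Type*} [DivisionRing K]
    [AddCommGroup M] [Module K M] [LinearOrder β] (v : α → M) (w : α → β) (E : Finset α) :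
    ∃ F ⊆ E, LinearIndepOn K v (F : Set α) ∧
      ∀ e ∈ E, v e ∈ Submodule.span K (v '' {f | f ∈ F ∧ w f ≤ w e}) := by
  classical
  induction E using Finset.induction_on_max_value w with
  | empty => exact ⟨∅, le_rfl, by simp, by simp⟩
  | insert a E ha hmax ih =>
    obtain ⟨F, hFE, hF, hspan⟩ := ih
    by_cases haF : v a ∈ Submodule.span K (v '' F)
    · refine ⟨F, hFE.trans (Finset.subset_insert _ _), hF, fun e he => ?_⟩
      rcases Finset.mem_insert.1 he with rfl | he
      · have hsub : (F : Set α) ⊆ {f | f ∈ F ∧ w f ≤ w e} := fun f hf => ⟨hf, hmax f (hFE hf)⟩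
        exact Submodule.span_mono (Set.image_mono hsub) haF
      · exact hspan e he
    · refine ⟨insert a F, Finset.insert_subset_insert _ hFE, ?_, fun e he => ?_⟩
      · rw [Finset.coe_insert]
        exact hF.insert haF
      · rcases Finset.mem_insert.1 he with rfl | he
        · exact Submodule.subset_span
            (Set.mem_image_of_mem _ ⟨Finset.mem_insert_self _ _, le_rfl⟩)
        · refine Submodule.span_mono (Set.image_mono fun f hf => ?_) (hspan e he)
          exact ⟨Finset.mem_insert_of_mem hf.1, hf.2⟩

namespace GraphicRank

variable {V : Type u}

/-- The incidence vector of an edge over the field with two elements, which makes acyclic edge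
sets linearly independent. -/
noncomputable def edgeVec : Sym2 V → V →₀ ZMod 2 :=
  Sym2.lift ⟨fun u v => Finsupp.single u 1 + Finsupp.single v 1, fun _ _ => add_comm _ _⟩

theorem edgeVec_mk (u v : V) : edgeVec s(u, v) = Finsupp.single u 1 + Finsupp.single v 1 := rfl

theorem edgeVec_self (u : V) : edgeVec s(u, u) = 0 := by
  rw [edgeVec_mk, ← Finsupp.single_add, CharTwo.add_self_eq_zero, Finsupp.single_zero]

theorem edgeVec_add_edgeVec (u v w : V) : edgeVec s(u, v) + edgeVec s(v, w) = edgeVec s(u, w) := by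
  have hself : Finsupp.single v (1 : ZMod 2) + Finsupp.single v 1 = 0 := edgeVec_self v
  rw [edgeVec_mk, edgeVec_mk, edgeVec_mk, add_assoc, ← add_assoc (Finsupp.single v 1), hself,
    zero_add]

/-- The span of the incidence vectors of the edges in `E`: by
`edgeVec_mem_edgeSpan_iff_reachable`, it records the connected components. -/
noncomputable def edgeSpan (E : Set (Sym2 V)) : Submodule (ZMod 2) (V →₀ ZMod 2) :=
  Submodule.span (ZMod 2) (edgeVec '' E)

theorem edgeSpan_mono {E F : Set (Sym2 V)} (h : E ⊆ F) : edgeSpan E ≤ edgeSpan F :=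
  Submodule.span_mono (Set.image_mono h)

theorem edgeVec_mem_edgeSpan {E : Set (Sym2 V)} {e : Sym2 V} (h : e ∈ E) :
    edgeVec e ∈ edgeSpan E :=
  Submodule.subset_span (Set.mem_image_of_mem _ h)

theorem edgeSpan_le_iff {E : Set (Sym2 V)} {N : Submodule (ZMod 2) (V →₀ ZMod 2)} :
    edgeSpan E ≤ N ↔ ∀ e ∈ E, edgeVec e ∈ N :=
  Submodule.span_le.trans Set.forall_mem_image

theorem edgeVec_mem_edgeSpan_of_reachable {E : Set (Sym2 V)} {u v : V}
    (h : (SimpleGraph.fromEdgeSet E).Reachable u v) : edgeVec s(u, v) ∈ edgeSpan E := by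
  obtain ⟨p⟩ := h
  induction p with
  | nil =>
    rw [edgeVec_self]
    exact Submodule.zero_mem _
  | cons hadj _ ih =>
    rw [← edgeVec_add_edgeVec]
    exact Submodule.add_mem _
      (edgeVec_mem_edgeSpan ((SimpleGraph.fromEdgeSet_adj _).1 hadj).1) ih

/- If `v` is not reachable from `u`, then the sum of the coordinates over the component of `u`
vanishes on all edges in `E`, but not on `s(u, v)`. -/
theorem reachable_of_edgeVec_mem_edgeSpan {E : Set (Sym2 V)} {u v : V}
    (h : edgeVec s(u, v) ∈ edgeSpan E) : (SimpleGraph.fromEdgeSet E).Reachable u v := by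
  classical
  by_contra hn
  let χ (w : V) : ZMod 2 := if (SimpleGraph.fromEdgeSet E).Reachable u w then 1 else 0
  let φ : (V →₀ ZMod 2) →ₗ[ZMod 2] ZMod 2 := Finsupp.linearCombination (ZMod 2) χ
  have hφ (a b : V) : φ (edgeVec s(a, b)) = χ a + χ b := by
    simp [φ, edgeVec_mk, Finsupp.linearCombination_single]
  have hχ (a b : V) (hab : s(a, b) ∈ E) : χ a = χ b := by
    rcases eq_or_ne a b with rfl | hne
    · rfl
    · have hadj := (SimpleGraph.fromEdgeSet_adj E).2 ⟨hab, hne⟩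
      have hiff : (SimpleGraph.fromEdgeSet E).Reachable u a ↔
          (SimpleGraph.fromEdgeSet E).Reachable u b :=
        ⟨fun h => h.trans hadj.reachable, fun h => h.trans hadj.symm.reachable⟩
      simp only [χ, hiff]
  have hker : edgeSpan E ≤ LinearMap.ker φ := by
    refine edgeSpan_le_iff.2 fun e he => ?_
    induction e using Sym2.ind with
    | _ a b => rw [LinearMap.mem_ker, hφ, hχ a b he, CharTwo.add_self_eq_zero]
  have huv := LinearMap.mem_ker.1 (hker h)
  simp [hφ, χ, hn] at huv

theorem edgeVec_mem_edgeSpan_iff_reachable {E : Set (Sym2 V)} {u v : V} :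
    edgeVec s(u, v) ∈ edgeSpan E ↔ (SimpleGraph.fromEdgeSet E).Reachable u v :=
  ⟨reachable_of_edgeVec_mem_edgeSpan, edgeVec_mem_edgeSpan_of_reachable⟩

theorem isBridge_fromEdgeSet_iff {F : Set (Sym2 V)} {a b : V} :
    (SimpleGraph.fromEdgeSet F).IsBridge s(a, b) ↔
      edgeVec s(a, b) ∉ edgeSpan (F \ {s(a, b)}) := by
  have hdelete : (SimpleGraph.fromEdgeSet F).deleteEdges {s(a, b)} =
      SimpleGraph.fromEdgeSet (F \ {s(a, b)}) := by
    ext x y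
    simp only [SimpleGraph.deleteEdges_adj, SimpleGraph.fromEdgeSet_adj, Set.mem_sdiff]
    tauto
  rw [SimpleGraph.isBridge_iff, hdelete, edgeVec_mem_edgeSpan_iff_reachable]

theorem isAcyclic_fromEdgeSet_iff {F : Set (Sym2 V)} (hF : ∀ e ∈ F, ¬ e.IsDiag) :
    (SimpleGraph.fromEdgeSet F).IsAcyclic ↔ LinearIndepOn (ZMod 2) edgeVec F := by
  rw [linearIndepOn_iff_notMem_span, SimpleGraph.isAcyclic_iff_forall_adj_isBridge]
  constructor
  · intro h e he
    induction e using Sym2.ind with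
    | _ a b =>
      have hab : a ≠ b := fun hab => hF _ he (Sym2.mk_isDiag_iff.2 hab)
      exact isBridge_fromEdgeSet_iff.1 (h ((SimpleGraph.fromEdgeSet_adj _).2 ⟨he, hab⟩))
  · intro h a b hab
    exact isBridge_fromEdgeSet_iff.2 (h _ ((SimpleGraph.fromEdgeSet_adj _).1 hab).1)

theorem forall_reachable_iff {E F : Set (Sym2 V)} :
    (∀ a b, (SimpleGraph.fromEdgeSet E).Reachable a b →
      (SimpleGraph.fromEdgeSet F).Reachable a b) ↔ edgeSpan E ≤ edgeSpan F := by
  simp only [← edgeVec_mem_edgeSpan_iff_reachable]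
  refine ⟨fun h => edgeSpan_le_iff.2 fun e he => ?_, fun h a b hab => h hab⟩
  induction e using Sym2.ind with
  | _ a b => exact h a b (edgeVec_mem_edgeSpan he)

/-- The rank of a set of edges in the graphic matroid: the number of edges of a spanning
forest. -/
noncomputable def rank (E : Finset (Sym2 V)) : ℕ :=
  Module.finrank (ZMod 2) (edgeSpan (E : Set (Sym2 V)))

instance (E : Finset (Sym2 V)) : FiniteDimensional (ZMod 2) (edgeSpan (E : Set (Sym2 V))) :=
  FiniteDimensional.span_of_finite _ (E.finite_toSet.image _)

theorem rank_le_rank {E F : Finset (Sym2 V)}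
    (h : edgeSpan (E : Set (Sym2 V)) ≤ edgeSpan (F : Set (Sym2 V))) : rank E ≤ rank F :=
  Submodule.finrank_mono h

theorem rank_mono {E F : Finset (Sym2 V)} (h : E ⊆ F) : rank E ≤ rank F :=
  rank_le_rank (edgeSpan_mono (Finset.coe_subset.2 h))

theorem rank_eq_card {F : Finset (Sym2 V)}
    (hF : LinearIndepOn (ZMod 2) edgeVec (F : Set (Sym2 V))) : rank F = F.card := by
  rw [rank, edgeSpan, Set.image_eq_range]
  simpa using finrank_span_eq_card hF

section

variable [DecidableEq V]

theorem edgeSpan_insert (e : Sym2 V) (E : Finset (Sym2 V)) :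
    edgeSpan (insert e E : Finset (Sym2 V)) =
      edgeSpan (E : Set (Sym2 V)) ⊔ Submodule.span (ZMod 2) {edgeVec e} := by
  rw [edgeSpan, Finset.coe_insert, Set.image_insert_eq, Submodule.span_insert, sup_comm, edgeSpan]

theorem rank_insert_of_mem {e : Sym2 V} {E : Finset (Sym2 V)}
    (h : edgeVec e ∈ edgeSpan (E : Set (Sym2 V))) : rank (insert e E) = rank E := by
  rw [rank, edgeSpan_insert, sup_eq_left.2 ((Submodule.span_singleton_le_iff_mem _ _).2 h), rank]

theorem rank_insert_of_notMem {e : Sym2 V} {E : Finset (Sym2 V)}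
    (h : edgeVec e ∉ edgeSpan (E : Set (Sym2 V))) : rank (insert e E) = rank E + 1 := by
  have hne : edgeVec e ≠ 0 := fun h0 => h (h0 ▸ Submodule.zero_mem _)
  have hdim := Submodule.finrank_sup_add_finrank_inf_eq (edgeSpan (E : Set (Sym2 V)))
    (Submodule.span (ZMod 2) {edgeVec e})
  rw [finrank_span_singleton hne,
    (Submodule.disjoint_span_singleton_of_notMem h).eq_bot, finrank_bot, add_zero] at hdim
  rw [rank, edgeSpan_insert, hdim, rank]

open Classical in
theorem rank_sub_rank_sdiff (E : Finset (Sym2 V)) (e : Sym2 V) :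
    (rank E : ℝ) - rank (E \ {e}) = (if e ∈ E then 1 else 0) *
      if edgeVec e ∉ edgeSpan (E \ {e} : Finset (Sym2 V)) then 1 else 0 := by
  by_cases he : e ∈ E
  · have hinsert : rank E = rank (insert e (E \ {e})) := by
      rw [Finset.sdiff_singleton_eq_erase, Finset.insert_erase he]
    by_cases hspan : edgeVec e ∈ edgeSpan (E \ {e} : Finset (Sym2 V))
    · rw [hinsert, rank_insert_of_mem hspan, sub_self, if_neg (not_not.2 hspan), mul_zero]
    · rw [hinsert, rank_insert_of_notMem hspan, if_pos he, if_pos hspan]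
      push_cast
      ring
  · rw [Finset.sdiff_singleton_eq_erase, Finset.erase_eq_of_notMem he, sub_self, if_neg he,
      zero_mul]

theorem antitone_edgeVec_notMem_edgeSpan_sdiff (e : Sym2 V) :
    Antitone fun E : Finset (Sym2 V) => edgeVec e ∉ edgeSpan (E \ {e} : Finset (Sym2 V)) :=
  fun _ _ h he heE => he <|
    edgeSpan_mono (Finset.coe_subset.2 (Finset.sdiff_subset_sdiff h (Finset.Subset.refl _))) heE

theorem variationLE_rank_sub_rank_sdiff {E : ℕ → Finset (Sym2 V)} (hE : Monotone E ∨ Antitone E)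
    (e : Sym2 V) : VariationLE (fun t => (rank (E t) : ℝ) - rank (E t \ {e})) 4 := by
  classical
  simp only [rank_sub_rank_sdiff]
  have hmem := VariationLE.indicator (p := fun t => e ∈ E t)
    (hE.imp (fun h _ _ hst he => h hst he) (fun h _ _ hst he => h hst he))
  have hnotMem := VariationLE.indicator
    (hE.symm.imp (antitone_edgeVec_notMem_edgeSpan_sdiff e).comp
      (antitone_edgeVec_notMem_edgeSpan_sdiff e).comp_monotone)
  have hmul := hmem.mul (α := 1) (β := 1) hnotMem (fun t => by split_ifs <;> simp)
    (fun t => by split_ifs <;> simp)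
  exact hmul.mono (by norm_num)

end

end GraphicRank

/-! ### Minimum spanning forests -/

theorem sum_eq_sum_range_card_sub {α : Type*} (F : Finset α) (w : α → ℕ) {W : ℕ}
    (hW : ∀ e ∈ F, w e ≤ W) :
    ((∑ e ∈ F, w e : ℕ) : ℝ) = ∑ i ∈ Finset.range W, ((F.card : ℝ) - {e ∈ F | w e ≤ i}.card) := by
  have hcard (i : ℕ) : (F.card : ℝ) - {e ∈ F | w e ≤ i}.card =
      ∑ e ∈ F, if i < w e then (1 : ℝ) else 0 := by
    rw [Finset.sum_boole, ← Finset.card_filter_add_card_filter_not (fun e => w e ≤ i) (s := F)]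
    simp only [not_le]
    push_cast
    ring
  simp only [hcard]
  rw [Finset.sum_comm, Nat.cast_sum]
  refine Finset.sum_congr rfl fun e he => ?_
  have hrange : ({i ∈ Finset.range W | i < w e} : Finset ℕ) = Finset.range (w e) := by
    ext i
    have := hW e he
    simp only [Finset.mem_filter, Finset.mem_range]
    omega
  rw [Finset.sum_boole, hrange, Finset.card_range]

namespace WGraph

open GraphicRank

variable {V : Type u}

theorem isSpanningForest_iff {G : WGraph V} (hG : ∀ e ∈ G.edges, ¬ e.IsDiag)
    {F : Finset (Sym2 V)} : G.IsSpanningForest F ↔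
      F ⊆ G.edges ∧ LinearIndepOn (ZMod 2) edgeVec (F : Set (Sym2 V)) ∧
        edgeSpan (G.edges : Set (Sym2 V)) ≤ edgeSpan (F : Set (Sym2 V)) :=
  and_congr_right fun hF => and_congr (isAcyclic_fromEdgeSet_iff fun e he => hG e (hF he))
    forall_reachable_iff

/-- The edges of weight at most `i`. -/
def lightEdges (G : WGraph V) (i : ℕ) : Finset (Sym2 V) := {e ∈ G.edges | G.weight e ≤ i}

/-- The weight of the forest found by Kruskal's algorithm if all weights are at most `W`: it has
`rank G.edges - rank (G.lightEdges i)` edges of weight greater than `i`. -/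
noncomputable def kruskalWeight (W : ℕ) (G : WGraph V) : ℝ :=
  ∑ i ∈ Finset.range W, ((rank G.edges : ℝ) - rank (G.lightEdges i))

variable {G : WGraph V} {F : Finset (Sym2 V)} {W : ℕ}

theorem IsSpanningForest.rank_eq_card (hF : G.IsSpanningForest F)
    (hG : ∀ e ∈ G.edges, ¬ e.IsDiag) : rank G.edges = F.card := by
  obtain ⟨hsub, hindep, hspan⟩ := (isSpanningForest_iff hG).1 hF
  rw [← GraphicRank.rank_eq_card hindep]
  exact (rank_le_rank hspan).antisymm (rank_mono hsub)

theorem IsSpanningForest.sum_weight_eq (hF : G.IsSpanningForest F)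
    (hG : ∀ e ∈ G.edges, ¬ e.IsDiag) (hW : G.MaxWeightLE W) :
    ((∑ e ∈ F, G.weight e : ℕ) : ℝ) =
      ∑ i ∈ Finset.range W, ((rank G.edges : ℝ) - rank {e ∈ F | G.weight e ≤ i}) := by
  obtain ⟨hsub, hindep, -⟩ := (isSpanningForest_iff hG).1 hF
  rw [sum_eq_sum_range_card_sub F G.weight fun e he => hW e (hsub he), hF.rank_eq_card hG]
  refine Finset.sum_congr rfl fun i _ => ?_
  rw [GraphicRank.rank_eq_card (hindep.mono (Finset.coe_subset.2 (Finset.filter_subset _ _)))]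

theorem IsSpanningForest.kruskalWeight_le (hF : G.IsSpanningForest F)
    (hG : ∀ e ∈ G.edges, ¬ e.IsDiag) (hW : G.MaxWeightLE W) :
    G.kruskalWeight W ≤ (∑ e ∈ F, G.weight e : ℕ) := by
  rw [hF.sum_weight_eq hG hW, kruskalWeight]
  gcongr
  exact rank_mono (Finset.filter_subset_filter _ hF.1)

theorem exists_isSpanningForest_sum_weight_eq (hG : ∀ e ∈ G.edges, ¬ e.IsDiag)
    (hW : G.MaxWeightLE W) :
    ∃ F, G.IsSpanningForest F ∧ ((∑ e ∈ F, G.weight e : ℕ) : ℝ) = G.kruskalWeight W := by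
  obtain ⟨F, hsub, hindep, hspan⟩ :=
    exists_linearIndepOn_forall_mem_span_sublevel (ZMod 2) edgeVec G.weight G.edges
  have hF : G.IsSpanningForest F := (isSpanningForest_iff hG).2 ⟨hsub, hindep,
    edgeSpan_le_iff.2 fun e he => edgeSpan_mono (fun f hf => hf.1) (hspan e he)⟩
  refine ⟨F, hF, (hF.sum_weight_eq hG hW).trans (Finset.sum_congr rfl fun i _ => ?_)⟩
  have hlight : edgeSpan (G.lightEdges i : Set (Sym2 V)) ≤
      edgeSpan ({e ∈ F | G.weight e ≤ i} : Finset (Sym2 V)) := by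
    refine edgeSpan_le_iff.2 fun e he => ?_
    obtain ⟨he, hei⟩ := Finset.mem_filter.1 he
    exact edgeSpan_mono (fun f hf => Finset.mem_filter.2 ⟨hf.1, hf.2.trans hei⟩) (hspan e he)
  rw [(rank_mono (Finset.filter_subset_filter _ hsub)).antisymm (rank_le_rank hlight), lightEdges]

theorem mstWeight_eq_kruskalWeight (hG : ∀ e ∈ G.edges, ¬ e.IsDiag) (hW : G.MaxWeightLE W) :
    (G.mstWeight : ℝ) = G.kruskalWeight W := by
  obtain ⟨F, hF, hsum⟩ := exists_isSpanningForest_sum_weight_eq hG hW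
  rw [← hsum]
  refine congrArg Nat.cast (le_antisymm (Nat.sInf_le ⟨F, hF, rfl⟩)
    (le_csInf ⟨_, F, hF, rfl⟩ ?_))
  rintro _ ⟨F', hF', rfl⟩
  exact_mod_cast hsum.le.trans (hF'.kruskalWeight_le hG hW)

theorem mstWeight_congr {H : WGraph V} (hedges : G.edges = H.edges)
    (hweight : ∀ e ∈ G.edges, G.weight e = H.weight e) : G.mstWeight = H.mstWeight := by
  have hforest (F : Finset (Sym2 V)) : G.IsSpanningForest F ↔ H.IsSpanningForest F := by
    simp only [IsSpanningForest, hedges]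
  refine congrArg sInf (Set.ext fun x => exists_congr fun F => ?_)
  rw [← hforest F]
  exact and_congr_right fun hF => by rw [Finset.sum_congr rfl fun e he => hweight e (hF.1 he)]

theorem IsDynamicFamily.monotone_or_antitone_lightEdges {G : ℕ → WGraph V}
    (hG : IsDynamicFamily G) (i : ℕ) :
    Monotone (fun t => (G t).lightEdges i) ∨ Antitone (fun t => (G t).lightEdges i) := by
  obtain ⟨w, hw⟩ := hG.exists_weight
  have hlight (t : ℕ) : (G t).lightEdges i = {e ∈ (G t).edges | w e ≤ i} :=
    Finset.filter_congr fun e he => by rw [hw t e he]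
  simp only [hlight]
  exact hG.monotone_or_antitone_comp (φ := fun G => {e ∈ G.edges | w e ≤ i})
    fun _ _ _ h => Finset.filter_subset_filter _ h

variable [DecidableEq V]

theorem lightEdges_eraseEdges (G : WGraph V) (X : Finset (Sym2 V)) (i : ℕ) :
    (G.eraseEdges X).lightEdges i = G.lightEdges i \ X := by
  ext e
  rw [lightEdges, Finset.mem_filter, Finset.mem_sdiff, lightEdges, Finset.mem_filter]
  by_cases heX : e ∈ X <;> simp [eraseEdges, heX]

theorem kruskalWeight_sub_eraseEdges (W : ℕ) (G : WGraph V) (X : Finset (Sym2 V)) :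
    G.kruskalWeight W - (G.eraseEdges X).kruskalWeight W =
      ∑ i ∈ Finset.range W, (((rank G.edges : ℝ) - rank (G.edges \ X)) -
        ((rank (G.lightEdges i) : ℝ) - rank (G.lightEdges i \ X))) := by
  have hedges : (G.eraseEdges X).edges = G.edges \ X := rfl
  simp only [kruskalWeight, lightEdges_eraseEdges, hedges, ← Finset.sum_sub_distrib]
  exact Finset.sum_congr rfl fun i _ => sub_sub_sub_comm _ _ _ _

theorem edgeVariationLE_mstWeight {Q : WGraph V → Prop}
    (hQ : ∀ G, Q G → G.MaxWeightLE W) :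
    EdgeVariationLE Q (fun G : WGraph V => (G.mstWeight : ℝ)) (8 * W) := by
  intro G hG hQG e
  have hW (t : ℕ) : (G t).MaxWeightLE W := hQ _ (hQG t)
  have hdiff (t : ℕ) : ((G t).mstWeight : ℝ) - ((G t).eraseEdges {e}).mstWeight =
      (G t).kruskalWeight W - ((G t).eraseEdges {e}).kruskalWeight W := by
    rw [mstWeight_eq_kruskalWeight (hG.not_isDiag t) (hW t),
      mstWeight_eq_kruskalWeight ((hG.eraseEdges {e}).not_isDiag t)
        (hereditaryEdges_maxWeightLE W _ _ (hW t))]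
  simp only [hdiff, kruskalWeight_sub_eraseEdges]
  have hedges : Monotone (fun t => (G t).edges) ∨ Antitone (fun t => (G t).edges) :=
    hG.monotone_or_antitone.imp And.right And.right
  refine (VariationLE.sum (Finset.range W) fun i _ =>
    (variationLE_rank_sub_rank_sdiff hedges e).sub
      (variationLE_rank_sub_rank_sdiff (hG.monotone_or_antitone_lightEdges i) e)).mono ?_
  rw [Finset.sum_const, Finset.card_range, nsmul_eq_mul]
  linarith

theorem isolatedVariationLE_mstWeight {Q : WGraph V → Prop} :
    IsolatedVariationLE Q (fun G : WGraph V => (G.mstWeight : ℝ)) 0 := by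
  intro G _ _ x hx
  have heq (t : ℕ) : (G t).mstWeight = ((G t).eraseVert x).mstWeight :=
    mstWeight_congr (eraseVert_edges_of_incident_eq_empty (hx t)).symm fun e he =>
      (if_neg (Finset.filter_eq_empty_iff.1 (hx t) he)).symm
  simpa [heq] using VariationLE.zero

end WGraph

/-! ### Continual sensitivity of the graph functions -/

theorem GraphSeq.WeightLE.maxWeightLE {V : Type u} [DecidableEq V] {T W : ℕ} {S : GraphSeq V T}
    (h : S.WeightLE W) (i : Fin T) : (S.graph i.succ).MaxWeightLE W := fun e he => by
  have he : e ∈ S.edges i.succ := he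
  simp only [GraphSeq.graph, if_pos he]
  exact (h i e he).2

namespace WGraph

variable {V : Type u} [DecidableEq V] {T : ℕ}

section Scalar

variable {P : GraphSeq V T → Prop} {Q : WGraph V → Prop} {f : WGraph V → ℕ} {B Γ : ℝ}

theorem EdgeVariationLE.continualSensitivityLE_scalar
    (hf : EdgeVariationLE Q (fun G => (f G : ℝ)) B) (hT : 0 < T)
    (hP : ∀ S, P S → ∀ i : Fin T, Q (S.graph i.succ)) (hΓ : B + B ≤ Γ) :
    ContinualSensitivityLE P GraphSeq.EdgeAdj (scalar f) Γ :=
  (EdgeVariationLE.continualSensitivityLE (fun _ => hf) hT hP).mono (by simpa using hΓ)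

theorem NodeVariationLE.continualSensitivityLE_scalar
    (hf : NodeVariationLE Q (fun G => (f G : ℝ)) B) (hT : 0 < T)
    (hP : ∀ S, P S → ∀ i : Fin T, Q (S.graph i.succ)) (hΓ : B + B ≤ Γ) :
    ContinualSensitivityLE P GraphSeq.NodeAdj (scalar f) Γ :=
  (NodeVariationLE.continualSensitivityLE (fun _ => hf) hT hP).mono (by simpa using hΓ)

end Scalar

theorem continualSensitivityLE_edgeAdj_mstWeight (hT : 0 < T) (W : ℕ) :
    ContinualSensitivityLE (fun S : GraphSeq V T => S.WeightLE W) GraphSeq.EdgeAdj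
      (scalar mstWeight) (16 * W) :=
  (edgeVariationLE_mstWeight fun _ h => h).continualSensitivityLE_scalar hT
    (fun _ h => h.maxWeightLE) (by linarith)

theorem continualSensitivityLE_nodeAdj_mstWeight (hT : 0 < T) (D W : ℕ) :
    ContinualSensitivityLE (fun S : GraphSeq V T => S.DegreeLE D ∧ S.WeightLE W) GraphSeq.NodeAdj
      (scalar mstWeight) (16 * (D * W)) := by
  let Q (G : WGraph V) : Prop := G.MaxDegreeLE D ∧ G.MaxWeightLE W
  have hQ : HereditaryEdges Q := fun G X h =>
    ⟨hereditaryEdges_maxDegreeLE D G X h.1, hereditaryEdges_maxWeightLE W G X h.2⟩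
  have hedge : EdgeVariationLE Q (fun G => (G.mstWeight : ℝ)) (8 * W) :=
    edgeVariationLE_mstWeight fun _ h => h.2
  exact (hedge.nodeVariationLE isolatedVariationLE_mstWeight hQ (fun _ h => h.1)
    (by positivity)).continualSensitivityLE_scalar hT (fun _ h i => ⟨h.1 i, h.2.maxWeightLE i⟩)
    (by linarith)

theorem continualSensitivityLE_edgeAdj_edgeCount (hT : 0 < T) :
    ContinualSensitivityLE (fun _ : GraphSeq V T => True) GraphSeq.EdgeAdj (scalar edgeCount) 4 :=
  edgeVariationLE_edgeCount.continualSensitivityLE_scalar (Q := fun _ => True) hT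
    (fun _ _ _ => trivial) (by norm_num)

theorem continualSensitivityLE_nodeAdj_edgeCount (hT : 0 < T) (D : ℕ) :
    ContinualSensitivityLE (fun S : GraphSeq V T => S.DegreeLE D) GraphSeq.NodeAdj
      (scalar edgeCount) (4 * D) :=
  (edgeVariationLE_edgeCount.nodeVariationLE isolatedVariationLE_edgeCount
    (hereditaryEdges_maxDegreeLE D) (fun _ h => h) (by norm_num)).continualSensitivityLE_scalar
    hT (fun _ h => h) (by linarith)

theorem continualSensitivityLE_edgeAdj_highDegreeCount (hT : 0 < T) (τ : ℕ) :
    ContinualSensitivityLE (fun _ : GraphSeq V T => True) GraphSeq.EdgeAdj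
      (scalar (highDegreeCount τ)) 16 :=
  (edgeVariationLE_highDegreeCount τ).continualSensitivityLE_scalar (Q := fun _ => True) hT
    (fun _ _ _ => trivial) (by norm_num)

theorem continualSensitivityLE_nodeAdj_highDegreeCount (hT : 0 < T) (D τ : ℕ) :
    ContinualSensitivityLE (fun S : GraphSeq V T => S.DegreeLE D) GraphSeq.NodeAdj
      (scalar (highDegreeCount τ)) (16 * D + 4) :=
  ((edgeVariationLE_highDegreeCount τ).nodeVariationLE (isolatedVariationLE_highDegreeCount τ)
    (hereditaryEdges_maxDegreeLE D) (fun _ h => h) (by norm_num)).continualSensitivityLE_scalar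
    hT (fun _ h => h) (by linarith)

theorem continualSensitivityLE_edgeAdj_degreeHistogram (hT : 0 < T) (D : ℕ) :
    ContinualSensitivityLE (fun S : GraphSeq V T => S.DegreeLE D) GraphSeq.EdgeAdj
      (degreeHistogram D) (32 * (D + 1)) := by
  refine (EdgeVariationLE.continualSensitivityLE (Q := MaxDegreeLE D) (f := degreeHistogram D)
    (fun j => edgeVariationLE_degreeBin (j : ℕ)) hT fun _ h => h).mono ?_
  rw [Fintype.card_fin]
  push_cast
  linarith

theorem continualSensitivityLE_nodeAdj_degreeHistogram (hT : 0 < T) (D : ℕ) :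
    ContinualSensitivityLE (fun S : GraphSeq V T => S.DegreeLE D) GraphSeq.NodeAdj
      (degreeHistogram D) ((D + 1) * (32 * D + 8)) := by
  have hbin (j : ℕ) : NodeVariationLE (MaxDegreeLE D)
      (fun G : WGraph V => (G.degreeBin j : ℝ)) (D * 16 + 4) :=
    (edgeVariationLE_degreeBin j).nodeVariationLE (isolatedVariationLE_degreeBin j)
      (hereditaryEdges_maxDegreeLE D) (fun _ h => h) (by norm_num)
  refine (NodeVariationLE.continualSensitivityLE (f := degreeHistogram D) (fun j => hbin j) hT
    fun _ h => h).mono ?_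
  rw [Fintype.card_fin]
  push_cast
  linarith

theorem continualSensitivityLE_edgeAdj_triangleCount (hT : 0 < T) (D : ℕ) :
    ContinualSensitivityLE (fun S : GraphSeq V T => S.DegreeLE D) GraphSeq.EdgeAdj
      (scalar triangleCount) (4 * D) :=
  (edgeVariationLE_triangleCount D).continualSensitivityLE_scalar hT (fun _ h => h) (by linarith)

theorem continualSensitivityLE_nodeAdj_triangleCount (hT : 0 < T) (D : ℕ) :
    ContinualSensitivityLE (fun S : GraphSeq V T => S.DegreeLE D) GraphSeq.NodeAdj
      (scalar triangleCount) (4 * D ^ 2) :=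
  ((edgeVariationLE_triangleCount D).nodeVariationLE isolatedVariationLE_triangleCount
    (hereditaryEdges_maxDegreeLE D) (fun _ h => h) (by positivity)).continualSensitivityLE_scalar
    hT (fun _ h => h) (by linarith)

theorem continualSensitivityLE_edgeAdj_kStarCount (hT : 0 < T) {D : ℕ} (hD : 1 ≤ D) (k : ℕ) :
    ContinualSensitivityLE (fun S : GraphSeq V T => S.DegreeLE D) GraphSeq.EdgeAdj
      (scalar (kStarCount k)) (8 * D ^ k) :=
  (edgeVariationLE_kStarCount hD k).continualSensitivityLE_scalar hT (fun _ h => h) (by linarith)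

theorem continualSensitivityLE_nodeAdj_kStarCount (hT : 0 < T) {D : ℕ} (hD : 1 ≤ D) (k : ℕ) :
    ContinualSensitivityLE (fun S : GraphSeq V T => S.DegreeLE D) GraphSeq.NodeAdj
      (scalar (kStarCount k)) (12 * D ^ k) :=
  (nodeVariationLE_kStarCount hD k).continualSensitivityLE_scalar hT (fun _ h => h) (by linarith)

end WGraph

theorem theorem1 :
    ∃ C : ℝ, 0 < C ∧
      ∀ (V : Type u) [DecidableEq V] (T : ℕ), 2 ≤ T →
      ∀ ε δ : ℝ, 0 < ε → 0 < δ →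
      ∀ D W : ℕ, 1 ≤ D → 1 ≤ W →
      ∀ τ k : ℕ,
        -- minimum spanning tree
        (HasPrivateAlgorithm (V := V) (T := T) (fun S => S.WeightLE W) GraphSeq.EdgeAdj
            (scalar WGraph.mstWeight) ε δ (C * (W * baseError T ε δ)) ∧
          HasPrivateAlgorithm (V := V) (T := T) (fun S => S.DegreeLE D ∧ S.WeightLE W)
            GraphSeq.NodeAdj (scalar WGraph.mstWeight) ε δ (C * (D * W * baseError T ε δ))) ∧
        -- edge count
        (HasPrivateAlgorithm (V := V) (T := T) (fun _ => True) GraphSeq.EdgeAdj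
            (scalar WGraph.edgeCount) ε δ (C * baseError T ε δ) ∧
          HasPrivateAlgorithm (V := V) (T := T) (fun S => S.DegreeLE D) GraphSeq.NodeAdj
            (scalar WGraph.edgeCount) ε δ (C * (D * baseError T ε δ))) ∧
        -- number of nodes of degree at least `τ`
        (HasPrivateAlgorithm (V := V) (T := T) (fun _ => True) GraphSeq.EdgeAdj
            (scalar (WGraph.highDegreeCount τ)) ε δ (C * baseError T ε δ) ∧
          HasPrivateAlgorithm (V := V) (T := T) (fun S => S.DegreeLE D) GraphSeq.NodeAdj
            (scalar (WGraph.highDegreeCount τ)) ε δ (C * (D * baseError T ε δ))) ∧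
        -- degree histogram
        (HasPrivateAlgorithm (V := V) (T := T) (fun S => S.DegreeLE D) GraphSeq.EdgeAdj
            (degreeHistogram D) ε δ (C * (D * baseError T ε δ)) ∧
          HasPrivateAlgorithm (V := V) (T := T) (fun S => S.DegreeLE D) GraphSeq.NodeAdj
            (degreeHistogram D) ε δ (C * (D ^ 2 * baseError T ε δ))) ∧
        -- triangle count
        (HasPrivateAlgorithm (V := V) (T := T) (fun S => S.DegreeLE D) GraphSeq.EdgeAdj
            (scalar WGraph.triangleCount) ε δ (C * (D * baseError T ε δ)) ∧
          HasPrivateAlgorithm (V := V) (T := T) (fun S => S.DegreeLE D) GraphSeq.NodeAdj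
            (scalar WGraph.triangleCount) ε δ (C * (D ^ 2 * baseError T ε δ))) ∧
        -- `k`-star count
        (HasPrivateAlgorithm (V := V) (T := T) (fun S => S.DegreeLE D) GraphSeq.EdgeAdj
            (scalar (WGraph.kStarCount k)) ε δ (C * (D ^ k * baseError T ε δ)) ∧
          HasPrivateAlgorithm (V := V) (T := T) (fun S => S.DegreeLE D) GraphSeq.NodeAdj
            (scalar (WGraph.kStarCount k)) ε δ (C * (D ^ k * baseError T ε δ))) := by
  refine ⟨264 * 80, by norm_num, fun V _ T hT ε δ hε hδ D W hD hW τ k => ?_⟩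
  have hT₀ : 0 < T := two_pos.trans_le hT
  have hD' : (1 : ℝ) ≤ D := by exact_mod_cast hD
  have hW' : (1 : ℝ) ≤ W := by exact_mod_cast hW
  have hprivate {ι : Type} [Fintype ι] {P : GraphSeq V T → Prop}
      {Adj : GraphSeq V T → GraphSeq V T → Prop} {f : WGraph V → ι → ℝ} {Γ Γ' : ℝ}
      (h : ContinualSensitivityLE P Adj f Γ) (hΓ : Γ ≤ 80 * Γ') (hΓ' : 0 < Γ') :
      HasPrivateAlgorithm P Adj f ε δ (264 * 80 * (Γ' * baseError T ε δ)) := by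
    simpa only [mul_assoc] using (h.mono hΓ).hasPrivateAlgorithm (by positivity) hT hε hδ
  open WGraph in
  exact ⟨⟨hprivate (continualSensitivityLE_edgeAdj_mstWeight hT₀ W) (by linarith) (by positivity),
    hprivate (continualSensitivityLE_nodeAdj_mstWeight hT₀ D W) (by nlinarith) (by positivity)⟩,
    ⟨by simpa only [one_mul] using hprivate (Γ' := 1)
          (continualSensitivityLE_edgeAdj_edgeCount hT₀) (by norm_num) one_pos,
    hprivate (continualSensitivityLE_nodeAdj_edgeCount hT₀ D) (by linarith) (by positivity)⟩,
    ⟨by simpa only [one_mul] using hprivate (Γ' := 1)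
          (continualSensitivityLE_edgeAdj_highDegreeCount hT₀ τ) (by norm_num) one_pos,
    hprivate (continualSensitivityLE_nodeAdj_highDegreeCount hT₀ D τ) (by linarith)
      (by positivity)⟩,
    ⟨hprivate (continualSensitivityLE_edgeAdj_degreeHistogram hT₀ D) (by linarith) (by positivity),
    hprivate (continualSensitivityLE_nodeAdj_degreeHistogram hT₀ D) (by nlinarith) (by positivity)⟩,
    ⟨hprivate (continualSensitivityLE_edgeAdj_triangleCount hT₀ D) (by linarith) (by positivity),
    hprivate (continualSensitivityLE_nodeAdj_triangleCount hT₀ D) (by nlinarith) (by positivity)⟩,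
    ⟨hprivate (continualSensitivityLE_edgeAdj_kStarCount hT₀ hD k) (by gcongr; norm_num)
      (by positivity),
    hprivate (continualSensitivityLE_nodeAdj_kStarCount hT₀ hD k) (by gcongr; norm_num)
      (by positivity)⟩⟩
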